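/- Let $d\ge 1$. There is a constant $C>0$, depending only on $d$ (in particular independent of $\Lambda,\varepsilon,\delta,H$), such that the following holds. Setting. All functions are complex-valued. Let $\Omega=\prod_{i=1}^d(a_i,b_i)$ be a bounded open box, $\varepsilon>0$, and let $V^\delta:\Omega\to\mathbb{R}$ be a measurable potential with $0<V_{\min}\le V^\delta\le V_{\max}$ on $\Omega$. Let $H^1_P(\Omega)$ be the space of functions in $H^1(\Omega)$ that are periodic on $\partial\Omega$. For an open set $S\subset\Omega$ put $a_S(w,v)=\int_S \tfrac{\varepsilon^2}{2}\nabla w\cdot\nabla\overline v+V^\delta w\overline v\,dx$, $a=a_\Omega$, $\|v\|_a=a(v,v)^{1/2}$, $(f,v)=\int_\Omega f\overline v\,dx$, $\|f\|=(f,f)^{1/2}$. Let $K_1,\dots,K_N$ be a mesh of $\overline\Omega$, i.e. closed elements with pairwise disjoint interiors whose union is $\overline\Omega$. Each element is a nondegenerate simplex, or a nondegenerate convex image of the unit cube under a multilinear map (e.g. an interval or a convex quadrilateral), with its first-order (linear, respectively isoparametric multilinear) Lagrange basis functions $\eta_{j,k}$, one for each vertex. Let $H=\max_j\operatorname{diam}K_j$.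 Let $\tilde\mu=\sum_k\tfrac{\varepsilon^2}{2}|\nabla\eta_{j,k}|^2$ on $K_j$, $s_j(w,v)=\int_{K_j}\tilde\mu\, w\overline v\,dx$, $s(w,v)=\int_\Omega\tilde\mu\, w\overline v\,dx$, $\|v\|_s=s(v,v)^{1/2}$, $\|f\|_{s^{-1}}=\big(\int_\Omega\tilde\mu^{-1}|f|^2dx\big)^{1/2}$. On each $K_j$ let $\lambda_j^1\le\lambda_j^2\le\cdots$ be all eigenvalues, repeated according to multiplicity, of the problem $a_{K_j}(\phi,v)=\lambda s_j(\phi,v)$ for all $v\in H^1(K_j)$, and let $\phi_j^i\in H^1(K_j)$ be corresponding nonzero, pairwise $s_j$-orthogonal eigenfunctions, extended by zero to $\Omega$. Fix integers $l_j\ge0$ and let $$\pi v=\sum_{j=1}^N\sum_{i=1}^{l_j}\frac{s(v,\phi_j^i)}{s(\phi_j^i,\phi_j^i)}\phi_j^i,\qquad \Lambda=\min_{1\le j\le N}\lambda_j^{l_j+1}.$$ Let $\psi_j^i\in H^1_P(\Omega)$ be given by $a(\psi_j^i,v)+s(\pi\psi_j^i,\pi v)=s(\phi_j^i,\pi v)$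 for all $v\in H^1_P(\Omega)$, and let $V_{\mathrm{glo}}=\operatorname{span}\{\psi_j^i: 1\le i\le l_j,\ 1\le j\le N\}$. Claim. Let $f\in L^2(\Omega)$. Let $u\in H^1_P(\Omega)$ be the weak solution of $(-\tfrac{\varepsilon^2}{2}\Delta+V^\delta)u=f$ with periodic boundary conditions, i.e. $a(u,v)=(f,v)$ for all $v\in H^1_P(\Omega)$, and let $u_{\mathrm{glo}}\in V_{\mathrm{glo}}$ satisfy $a(u_{\mathrm{glo}},v)=(f,v)$ for all $v\in V_{\mathrm{glo}}$. Then $$\|u-u_{\mathrm{glo}}\|_a\le\frac{\|f\|_{s^{-1}}}{\sqrt\Lambda},\qquad \|u-u_{\mathrm{glo}}\|_s\le\frac{C}{\Lambda}\|f\|_{s^{-1}},$$ and consequently (first order in the energy norm, second order in $L^2$) $$\|u-u_{\mathrm{glo}}\|_a\le\frac{C H}{\varepsilon\sqrt\Lambda}\|f\|,\qquad \|u-u_{\mathrm{glo}}\|\le\frac{C H^2}{\Lambda\varepsilon^2}\|f\|.$$ -/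

import Mathlib

open MeasureTheory

noncomputable section

namespace CEM

/-! ### Boxes, Lagrange elements and coarse meshes -/

/-- Euclidean space `ℝ^d`. -/
abbrev E (d : ℕ) : Type := EuclideanSpace ℝ (Fin d)

/-- The open box `∏ᵢ (aᵢ, bᵢ)`, the period cell. -/
def box {d : ℕ} (a b : Fin d → ℝ) : Set (E d) := {x | ∀ i, a i < x i ∧ x i < b i}

/-- The two standard families of first order Lagrange elements: simplices (intervals, triangles,
tetrahedra) and cubes (intervals, quadrilaterals, hexahedra). -/
inductive CellKind : Type
  | simplex
  | cube

/-- The index set of the vertices of an element in dimension `d`. -/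
def CellKind.Vertex (d : ℕ) : CellKind → Type
  | .simplex => Option (Fin d)
  | .cube => Fin d → Bool

instance (d : ℕ) : (k : CellKind) → Fintype (k.Vertex d)
  | .simplex => inferInstanceAs (Fintype (Option (Fin d)))
  | .cube => inferInstanceAs (Fintype (Fin d → Bool))

/-- The closed reference element: unit simplex or unit cube. -/
def CellKind.refCell (d : ℕ) : CellKind → Set (E d)
  | .simplex => {t | (∀ i, 0 ≤ t i) ∧ ∑ i, t i ≤ 1}
  | .cube => {t | ∀ i, 0 ≤ t i ∧ t i ≤ 1}

/-- The Lagrange shape functions on the reference element: barycentric coordinates on the simplex,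
multilinear nodal functions on the cube. -/
def CellKind.shape (d : ℕ) : (k : CellKind) → k.Vertex d → E d → ℝ
  | .simplex => fun v t => match v with
      | none => 1 - ∑ i, t i
      | some i => t i
  | .cube => fun v t => ∏ i, if v i = true then t i else 1 - t i

/-- The (affine or multilinear) map from the reference element that sends its vertices
to the points `p`. -/
def refMap {d : ℕ} (k : CellKind) (p : k.Vertex d → E d) (t : E d) : E d :=
  ∑ v, k.shape d v t • p v

/-- A nondegenerate convex Lagrange element (simplex, convex quadrilateral, parallelepiped, ...),
given by its vertices. -/
structure LagrangeCell (d : ℕ) where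
  kind : CellKind
  vertex : kind.Vertex d → E d
  injOn : Set.InjOn (refMap kind vertex) (kind.refCell d)
  det_ne_zero : ∀ t ∈ kind.refCell d, (fderiv ℝ (refMap kind vertex) t).det ≠ 0
  convex : Convex ℝ (refMap kind vertex '' kind.refCell d)

namespace LagrangeCell

variable {d : ℕ} (K : LagrangeCell d)

/-- The closed element as a subset of `ℝ^d`. -/
def carrier : Set (E d) := refMap K.kind K.vertex '' K.kind.refCell d

/-- The open element. -/
def dom : Set (E d) := interior K.carrier

/-- The Lagrange basis function `η_v` of the vertex `v`, on the element `K`. -/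
def basis (v : K.kind.Vertex d) (x : E d) : ℝ :=
  K.kind.shape d v (Function.invFunOn (refMap K.kind K.vertex) (K.kind.refCell d) x)

/-- The weight `μ̃ = ∑_v (ε²/2) ∇η_v · ∇η_v` on the open element. -/
def weight (ε : ℝ) (x : E d) : ℝ :=
  ∑ v, ε ^ 2 / 2 * ‖gradient (K.basis v) x‖ ^ 2

end LagrangeCell

/-- A coarse mesh of the domain `Ω`: finitely many closed elements with pairwise disjoint interiors
that cover the closure of `Ω`. -/
structure CoarseMesh {d : ℕ} (Ω : Set (E d)) where
  N : ℕ
  cell : Fin N → LagrangeCell d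
  cover : ⋃ j, (cell j).carrier = closure Ω
  disjoint : ∀ i j, i ≠ j → Disjoint (cell i).dom (cell j).dom

namespace CoarseMesh

variable {d : ℕ} {Ω : Set (E d)} (T : CoarseMesh Ω)

/-- The mesh size `H`: the maximal diameter of the elements. -/
def size : ℝ := ⨆ j, Metric.diam (T.cell j).carrier

/-- The weight `μ̃` on the whole domain (put to zero on the mesh skeleton, a null set). -/
def weight (ε : ℝ) (x : E d) : ℝ :=
  ∑ j, (T.cell j).dom.indicator ((T.cell j).weight ε) x

end CoarseMesh

/-! ### Sobolev spaces -/

/-- `L²(U; ℂ)`. -/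
abbrev L2 {d : ℕ} (U : Set (E d)) : Type := Lp ℂ 2 (volume.restrict U)

/-- Pairs of a scalar field and a vector field in `L²(U)`, with the Hilbert norm
`(‖u‖² + ‖g‖²)^(1/2)`. A Sobolev function is stored as the pair of itself and its
weak gradient. -/
abbrev Pair {d : ℕ} (U : Set (E d)) : Type :=
  WithLp 2 (Lp ℂ 2 (volume.restrict U) × Lp (EuclideanSpace ℂ (Fin d)) 2 (volume.restrict U))

/-- `∫_U u ∂ᵢη = - ∫_U gᵢ η` for all `i`, where `w = (u, g)`. -/
def IntByParts {d : ℕ} (U : Set (E d)) (w : Pair U) (η : E d → ℝ) : Prop :=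
  ∀ i : Fin d,
    ∫ x in U, ((fderiv ℝ η x (EuclideanSpace.single i 1) : ℝ) : ℂ) * w.fst x =
      -∫ x in U, (η x : ℂ) * (w.snd x) i

/-- The Sobolev space `H¹(U)`: all `(u, g)` in `L²` such that `g` is the weak gradient of `u`. -/
def H1 {d : ℕ} (U : Set (E d)) : Set (Pair U) :=
  {w | ∀ η : E d → ℝ, ContDiff ℝ (⊤ : ℕ∞) η → HasCompactSupport η → tsupport η ⊆ U →
    IntByParts U w η}

/-- `η` has period `bᵢ - aᵢ` in the `i`-th coordinate direction, for every `i`. -/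
def IsPeriodic {d : ℕ} (a b : Fin d → ℝ) (η : E d → ℝ) : Prop :=
  ∀ (i : Fin d) (x : E d), η (x + EuclideanSpace.single i (b i - a i)) = η x

/-- The space `H¹_P` of the functions in `H¹(box a b)` that are periodic on the boundary.
Periodicity is expressed by integration by parts against smooth periodic functions without
boundary terms, that is, by the equality of the traces on opposite faces. -/
def H1P {d : ℕ} (a b : Fin d → ℝ) : Set (Pair (box a b)) :=
  {w | w ∈ H1 (box a b) ∧
    ∀ η : E d → ℝ, ContDiff ℝ (⊤ : ℕ∞) η → IsPeriodic a b η → IntByParts (box a b) w η}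

/-! ### Forms and norms -/

/-- `a(u, v) = ∫_U (ε²/2) ∇u · conj ∇v + V u conj v`. -/
def aForm {d : ℕ} (ε : ℝ) (V : E d → ℝ) {U : Set (E d)} (u v : Pair U) : ℂ :=
  ∫ x in U, (((ε ^ 2 / 2 : ℝ) : ℂ) * inner ℂ (v.snd x) (u.snd x) +
    (V x : ℂ) * u.fst x * starRingEnd ℂ (v.fst x))

/-- `s(u, v) = ∫_U μ u conj v` for the weight `μ`. -/
def sForm {d : ℕ} (μ : E d → ℝ) (U : Set (E d)) (u v : E d → ℂ) : ℂ :=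
  ∫ x in U, (μ x : ℂ) * u x * starRingEnd ℂ (v x)

/-- The `L²` product `(f, v) = ∫_U f conj v`. -/
def l2Form {d : ℕ} {U : Set (E d)} (f : L2 U) (v : Pair U) : ℂ :=
  ∫ x in U, f x * starRingEnd ℂ (v.fst x)

/-- The energy norm `‖v‖_a = a(v, v)^(1/2)`. -/
def aNorm {d : ℕ} (ε : ℝ) (V : E d → ℝ) {U : Set (E d)} (v : Pair U) : ℝ :=
  Real.sqrt (aForm ε V v v).re

/-- The norm `‖v‖_s = s(v, v)^(1/2)`. -/
def sNorm {d : ℕ} (μ : E d → ℝ) (U : Set (E d)) (v : E d → ℂ) : ℝ :=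
  Real.sqrt (sForm μ U v v).re

/-- The norm `‖v‖_{s⁻¹} = (∫_U μ⁻¹ |v|²)^(1/2)`. -/
def sInvNorm {d : ℕ} (μ : E d → ℝ) (U : Set (E d)) (v : E d → ℂ) : ℝ :=
  Real.sqrt (∫ x in U, (μ x)⁻¹ * ‖v x‖ ^ 2)

/-! ### Local eigenvalue problems and the multiscale space -/

/-- `a_K(φ, v) = r s_K(φ, v)` for all `v ∈ H¹(K)`. -/
def SolvesEig {d : ℕ} (ε : ℝ) (V : E d → ℝ) (K : LagrangeCell d) (r : ℝ) (φ : Pair K.dom) : Prop :=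
  φ ∈ H1 K.dom ∧
    ∀ v ∈ H1 K.dom, aForm ε V φ v = (r : ℂ) * sForm (K.weight ε) K.dom φ.fst v.fst

/-- `lam 0 ≤ lam 1 ≤ …` are all the eigenvalues of the local problem on `K`, repeated according to
multiplicity, and `φ 0, φ 1, …` are corresponding `s`-orthogonal eigenfunctions. (The numbering
starts at `0`.) -/
structure IsEigensystem {d : ℕ} (ε : ℝ) (V : E d → ℝ) (K : LagrangeCell d)
    (lam : ℕ → ℝ) (φ : ℕ → Pair K.dom) : Prop where
  eig : ∀ i, SolvesEig ε V K (lam i) (φ i)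
  ne_zero : ∀ i, φ i ≠ 0
  orthogonal : ∀ i k, i ≠ k → sForm (K.weight ε) K.dom (φ i).fst (φ k).fst = 0
  mono : Monotone lam
  all : ∀ (r : ℝ) (w : Pair K.dom), SolvesEig ε V K r w →
    w ∈ Submodule.span ℂ {ψ | ∃ i, lam i = r ∧ φ i = ψ}

section Multiscale

variable {d : ℕ} {Ω : Set (E d)} (T : CoarseMesh Ω)

/-- The `i`-th local eigenfunction on the `j`-th element, extended by zero. -/
def phiExt (φ : (j : Fin T.N) → ℕ → Pair (T.cell j).dom) (j : Fin T.N) (i : ℕ) : E d → ℂ :=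
  (T.cell j).dom.indicator (φ j i).fst

/-- The projection `π = ∑ⱼ πⱼ` onto the auxiliary space, which is spanned by the first `l j`
eigenfunctions of each element `j`: `πⱼ v = ∑_{i < l j} s(v, φⱼᵢ) / s(φⱼᵢ, φⱼᵢ) φⱼᵢ`. -/
def auxProj (ε : ℝ) (φ : (j : Fin T.N) → ℕ → Pair (T.cell j).dom) (l : Fin T.N → ℕ)
    (v : E d → ℂ) (x : E d) : ℂ :=
  ∑ j, ∑ i ∈ Finset.range (l j),
    sForm (T.weight ε) Ω v (phiExt T φ j i) /
      sForm (T.weight ε) Ω (phiExt T φ j i) (phiExt T φ j i) * phiExt T φ j i x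

/-- `Λ`, the smallest local eigenvalue left out of the auxiliary space. -/
def leastOmitted (lam : Fin T.N → ℕ → ℝ) (l : Fin T.N → ℕ) : ℝ := ⨅ j, lam j (l j)

end Multiscale

section Global

variable {d : ℕ} {a b : Fin d → ℝ} (T : CoarseMesh (box a b))

/-- `ψ ∈ H¹_P` is the global multiscale basis function of `φⱼᵢ`:
`a(ψ, v) + s(πψ, πv) = s(φⱼᵢ, πv)` for all `v ∈ H¹_P`. -/
def IsGlobalBasis (ε : ℝ) (V : E d → ℝ) (φ : (j : Fin T.N) → ℕ → Pair (T.cell j).dom)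
    (l : Fin T.N → ℕ) (j : Fin T.N) (i : ℕ) (ψ : Pair (box a b)) : Prop :=
  ψ ∈ H1P a b ∧ ∀ v ∈ H1P a b,
    aForm ε V ψ v +
        sForm (T.weight ε) (box a b) (auxProj T ε φ l ψ.fst) (auxProj T ε φ l v.fst) =
      sForm (T.weight ε) (box a b) (phiExt T φ j i) (auxProj T ε φ l v.fst)

/-- The global multiscale space `V_glo`, the span of the global basis functions. -/
def Vglo (ε : ℝ) (V : E d → ℝ) (φ : (j : Fin T.N) → ℕ → Pair (T.cell j).dom)
    (l : Fin T.N → ℕ) : Submodule ℂ (Pair (box a b)) :=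
  Submodule.span ℂ {ψ | ∃ j, ∃ i < l j, IsGlobalBasis T ε V φ l j i ψ}

/-- `u ∈ W` and `a(u, v) = (f, v)` for all `v ∈ W`. With `W = H¹_P` this is the weak form of
`-(ε²/2) Δu + V u = f` with periodic boundary conditions, with `W = V_glo` its Galerkin
approximation. -/
def SolvesIn (ε : ℝ) (V : E d → ℝ) (W : Set (Pair (box a b))) (f : L2 (box a b))
    (u : Pair (box a b)) : Prop :=
  u ∈ W ∧ ∀ v ∈ W, aForm ε V u v = l2Form f v

end Global

end CEM

end

namespace CEM

open Filter Topology ComplexConjugate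
open scoped ENNReal

/-! ### Nonnegative Hermitian forms -/

/-! Put $e=u-u_{\mathrm{glo}}$. Galerkin orthogonality gives $a(e,\psi)=0$ on $V_{\mathrm{glo}}$ and
hence $\|e\|_a^2=(f,e)\le\|f\|_{s^{-1}}\|e\|_s$. Everything rests on the gap estimate
$\Lambda\|e\|_s^2\le\|e\|_a^2$. Combined with the duality bound it yields
$\sqrt\Lambda\,\|e\|_a\le\|f\|_{s^{-1}}$, and applied once more $\Lambda\|e\|_s\le\|f\|_{s^{-1}}$;
no Aubin-Nitsche argument is needed. The bounds with $H$ follow from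
$\tilde\mu\ge\varepsilon^2/(2\cdot2^dH^2)$ (`LagrangeCell.le_weight`).

The gap estimate has two ingredients. The first is $\pi e=0$ (`coeff_eq_zero_of_orthogonal`). The
combination $\Psi$ of the $\psi_j^i$ with the coefficients of $\pi e$ solves
$a(\Psi,v)+s(\pi\Psi,\pi v)=s(\pi e,\pi v)$, and $a(\Psi,e)=0$. Testing with $e$ and with $\Psi$
gives $a(\Psi,\Psi)=-\|\pi(\Psi-e)\|_s^2\le0$, so $\Psi=0$ and then $\pi e=0$.

The second is the min-max principle on each element (`IsEigensystem.le_aForm`): a function in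
$H^1(K_j)$ that is $s_j$-orthogonal to the first $l_j$ eigenfunctions has Rayleigh quotient at least
$\lambda_j^{l_j+1}$. Otherwise a maximizer of $s_j/a_{K_j}$ on that complement would be an
eigenfunction with a smaller eigenvalue, hence a combination of the first $l_j$ eigenfunctions,
hence orthogonal to itself. The maximizer exists by Rellich compactness
(`exists_rayleigh_maximizer`, `H1.exists_functionals`), which is derived from a Poincaré inequality
on convex sets; this is where convexity of the elements enters the local problem. -/

/-- A nonnegative Hermitian form, linear in the first argument. -/
structure IsHermForm {X : Type*} [AddCommGroup X] [Module ℂ X] (B : X → X → ℂ) : Prop where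
  add_left : ∀ x y z, B (x + y) z = B x z + B y z
  smul_left : ∀ (c : ℂ) x y, B (c • x) y = c * B x y
  conj_symm : ∀ x y, conj (B y x) = B x y
  nonneg : ∀ x, 0 ≤ (B x x).re

namespace IsHermForm

section Algebra

variable {X : Type*} [AddCommGroup X] [Module ℂ X] {B : X → X → ℂ}

/-- The form as a linear functional of its first argument. -/
def linear (hB : IsHermForm B) (y : X) : X →ₗ[ℂ] ℂ where
  toFun x := B x y
  map_add' x z := hB.add_left x z y
  map_smul' c x := by simpa using hB.smul_left c x y

lemma zero_left (hB : IsHermForm B) (y : X) : B 0 y = 0 := (hB.linear y).map_zero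

lemma sub_left (hB : IsHermForm B) (x y z : X) : B (x - y) z = B x z - B y z :=
  (hB.linear z).map_sub x y

lemma sum_left (hB : IsHermForm B) {ι : Type*} (s : Finset ι) (f : ι → X) (y : X) :
    B (∑ i ∈ s, f i) y = ∑ i ∈ s, B (f i) y :=
  map_sum (hB.linear y) f s

lemma add_right (hB : IsHermForm B) (x y z : X) : B x (y + z) = B x y + B x z := by
  rw [← hB.conj_symm, hB.add_left, map_add, hB.conj_symm, hB.conj_symm]

lemma smul_right (hB : IsHermForm B) (c : ℂ) (x y : X) : B x (c • y) = conj c * B x y := by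
  rw [← hB.conj_symm, hB.smul_left, map_mul, hB.conj_symm]

lemma sub_right (hB : IsHermForm B) (x y z : X) : B x (y - z) = B x y - B x z := by
  rw [← hB.conj_symm, hB.sub_left, map_sub, hB.conj_symm, hB.conj_symm]

lemma self_im (hB : IsHermForm B) (x : X) : (B x x).im = 0 :=
  Complex.conj_eq_iff_im.1 (hB.conj_symm x x)

lemma self_eq (hB : IsHermForm B) (x : X) : B x x = ((B x x).re : ℂ) :=
  Complex.ext (by simp) (by simp [hB.self_im])

lemma parallelogram (hB : IsHermForm B) (x y : X) :
    (B (x + y) (x + y)).re + (B (x - y) (x - y)).re = 2 * (B x x).re + 2 * (B y y).re := by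
  simp only [hB.add_left, hB.add_right, hB.sub_left, hB.sub_right, Complex.add_re, Complex.sub_re]
  ring

lemma self_smul (hB : IsHermForm B) (c : ℂ) (x : X) :
    (B (c • x) (c • x)).re = ‖c‖ ^ 2 * (B x x).re := by
  rw [hB.smul_left, hB.smul_right, ← mul_assoc, Complex.mul_conj, Complex.normSq_eq_norm_sq,
    Complex.re_ofReal_mul]

/-- The Cauchy-Schwarz inequality. -/
lemma norm_sq_le (hB : IsHermForm B) (x y : X) :
    ‖B x y‖ ^ 2 ≤ (B x x).re * (B y y).re := by
  -- The arguments are swapped because `inner` is linear in its second argument, whereas `B` is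
  -- linear in its first.
  let c : PreInnerProductSpace.Core ℂ X :=
    { inner := fun x y => B y x
      conj_inner_symm := fun x y => hB.conj_symm y x
      re_inner_nonneg := hB.nonneg
      add_left := fun x y z => hB.add_right z x y
      smul_left := fun x y r => hB.smul_right r y x }
  have h := @InnerProductSpace.Core.inner_mul_inner_self_le ℂ X _ _ _ c y x
  change ‖B x y‖ * ‖B y x‖ ≤ (B y y).re * (B x x).re at h
  rw [← hB.conj_symm y x, RCLike.norm_conj, ← sq] at h
  linarith

/-- By Cauchy-Schwarz an isotropic vector of a nonnegative form lies in its radical. This is how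
Euler-Lagrange equations are obtained below without differentiating. -/
lemma eq_zero_of_self_le (hB : IsHermForm B) {x : X} (hx : (B x x).re ≤ 0) (y : X) : B x y = 0 := by
  have h := hB.norm_sq_le x y
  have h0 : (B x x).re = 0 := le_antisymm hx (hB.nonneg x)
  rw [h0, zero_mul] at h
  simpa using le_antisymm h (sq_nonneg _)

end Algebra

section Topology

variable {X : Type*} [NormedAddCommGroup X] [NormedSpace ℂ X] {B : X → X → ℂ}

lemma norm_le (hB : IsHermForm B) {C : ℝ} (hC : 0 ≤ C) (h : ∀ x, (B x x).re ≤ C * ‖x‖ ^ 2)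
    (x y : X) : ‖B x y‖ ≤ C * ‖x‖ * ‖y‖ := by
  refine abs_le_of_sq_le_sq' ?_ (by positivity) |>.2
  calc ‖B x y‖ ^ 2 ≤ (B x x).re * (B y y).re := hB.norm_sq_le x y
    _ ≤ (C * ‖x‖ ^ 2) * (C * ‖y‖ ^ 2) :=
        mul_le_mul (h x) (h y) (hB.nonneg y) (by positivity)
    _ = _ := by ring

/-- A bounded form as a continuous linear functional of its first argument. -/
noncomputable def toCLM (hB : IsHermForm B) {C : ℝ} (hC : 0 ≤ C) (h : ∀ x, (B x x).re ≤ C * ‖x‖ ^ 2)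
    (y : X) : X →L[ℂ] ℂ :=
  (hB.linear y).mkContinuous (C * ‖y‖) fun x => by
    have := hB.norm_le hC h x y
    change ‖B x y‖ ≤ _
    linarith

lemma continuous_self (hB : IsHermForm B) {C : ℝ} (hC : 0 ≤ C)
    (h : ∀ x, (B x x).re ≤ C * ‖x‖ ^ 2) : Continuous fun x => (B x x).re := by
  refine continuous_iff_continuousAt.2 fun y => ?_
  have key : ∀ x, ‖B x x - B y y‖ ≤ C * ‖x - y‖ * ‖x‖ + C * ‖y‖ * ‖x - y‖ := fun x => by
    have : B x x - B y y = B (x - y) x + B y (x - y) := by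
      rw [hB.sub_left, hB.sub_right]; ring
    rw [this]
    exact (norm_add_le _ _).trans (add_le_add (hB.norm_le hC h _ _) (hB.norm_le hC h _ _))
  have hlim : Tendsto (fun x => C * ‖x - y‖ * ‖x‖ + C * ‖y‖ * ‖x - y‖) (𝓝 y) (𝓝 0) := by
    have : Continuous fun x => C * ‖x - y‖ * ‖x‖ + C * ‖y‖ * ‖x - y‖ := by fun_prop
    simpa using this.tendsto y
  have h1 : Tendsto (fun x => B x x) (𝓝 y) (𝓝 (B y y)) :=
    tendsto_iff_norm_sub_tendsto_zero.2 (squeeze_zero (fun _ => norm_nonneg _) key hlim)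
  exact (Complex.continuous_re.tendsto _).comp h1

end Topology

end IsHermForm

/-! ### Variational existence: Rayleigh maximizers and Riesz representation -/

/-- The Rayleigh quotient of a form `S` that is compact with respect to a coercive form `A`
attains its supremum on a closed subspace, and a maximizer solves the eigenvalue problem there. -/
theorem exists_rayleigh_maximizer {X : Type*} [NormedAddCommGroup X] [NormedSpace ℂ X]
    [CompleteSpace X] {A S : X → X → ℂ} (hA : IsHermForm A) (hS : IsHermForm S)
    {cA CA CS : ℝ} (hcA : 0 < cA) (hCA : 0 ≤ CA) (hCS : 0 ≤ CS)
    (hA_lower : ∀ x, cA * ‖x‖ ^ 2 ≤ (A x x).re) (hA_upper : ∀ x, (A x x).re ≤ CA * ‖x‖ ^ 2)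
    (hS_upper : ∀ x, (S x x).re ≤ CS * ‖x‖ ^ 2)
    (W : Submodule ℂ X) (hW : IsClosed (W : Set X))
    (hcomp : ∀ ε : ℝ, 0 < ε → ∃ (ι : Type) (_ : Fintype ι) (ℓ : ι → X →L[ℂ] ℂ), ∀ w ∈ W,
      (S w w).re ≤ ε * ‖w‖ ^ 2 + ∑ k, ‖ℓ k w‖ ^ 2)
    (hne : ∃ w ∈ W, 0 < (S w w).re) :
    ∃ M : ℝ, 0 < M ∧ (∀ w ∈ W, (S w w).re ≤ M * (A w w).re) ∧
      ∃ w₀ ∈ W, w₀ ≠ 0 ∧ ∀ v ∈ W, S w₀ v = M * A w₀ v := by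
  have hApos : ∀ x, x ≠ 0 → 0 < (A x x).re := fun x hx =>
    lt_of_lt_of_le (by have := norm_pos_iff.2 hx; positivity) (hA_lower x)
  set R : Set ℝ := {r | ∃ w ∈ W, (A w w).re = 1 ∧ (S w w).re = r} with hR
  have hnormalize : ∀ w ∈ W, w ≠ 0 → (S w w).re / (A w w).re ∈ R := by
    intro w hw hw0
    have hpos := hApos w hw0
    refine ⟨((Real.sqrt (A w w).re)⁻¹ : ℂ) • w, W.smul_mem _ hw, ?_, ?_⟩
    · rw [hA.self_smul, ← Complex.ofReal_inv, Complex.norm_real, Real.norm_eq_abs, sq_abs, inv_pow,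
        Real.sq_sqrt hpos.le, inv_mul_cancel₀ hpos.ne']
    · rw [hS.self_smul, ← Complex.ofReal_inv, Complex.norm_real, Real.norm_eq_abs, sq_abs, inv_pow,
        Real.sq_sqrt hpos.le, inv_mul_eq_div]
  have hnorm : ∀ x, (A x x).re = 1 → ‖x‖ ^ 2 ≤ 1 / cA := fun x hx => by
    rw [le_div_iff₀ hcA, mul_comm, ← hx]; exact hA_lower x
  have hbdd : BddAbove R := by
    refine ⟨CS * (1 / cA), ?_⟩
    rintro r ⟨w, -, hw1, rfl⟩
    exact (hS_upper w).trans (mul_le_mul_of_nonneg_left (hnorm w hw1) hCS)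
  obtain ⟨w₁, hw₁, hw₁S⟩ := hne
  have hw₁0 : w₁ ≠ 0 := by
    rintro rfl
    simp [hS.zero_left] at hw₁S
  set M := sSup R with hM
  have hMpos : 0 < M :=
    lt_of_lt_of_le (div_pos hw₁S (hApos w₁ hw₁0)) (le_csSup hbdd (hnormalize w₁ hw₁ hw₁0))
  have hle : ∀ w ∈ W, (S w w).re ≤ M * (A w w).re := by
    intro w hw
    rcases eq_or_ne w 0 with rfl | hw0
    · simp [hS.zero_left, hA.zero_left]
    · exact (div_le_iff₀ (hApos w hw0)).1 (le_csSup hbdd (hnormalize w hw hw0))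
  obtain ⟨r, -, hr, hrR⟩ := exists_seq_tendsto_sSup ⟨_, hnormalize w₁ hw₁ hw₁0⟩ hbdd
  choose x hxW hxA hxS using hrR
  have hxS' : Tendsto (fun n => (S (x n) (x n)).re) (hyperfilter ℕ : Filter ℕ) (𝓝 M) := by
    refine Tendsto.mono_left ?_ Nat.hyperfilter_le_atTop
    simpa only [hxS] using hr
  -- Strong convergence is obtained directly, without weak compactness: along an ultrafilter the
  -- finitely many bounded scalar sequences `ℓ k (x m)` converge, so `hcomp` makes the differences
  -- small in `S`, and the parallelogram law transfers this smallness to `A`.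
  have hCauchy : Cauchy (map x (hyperfilter ℕ : Filter ℕ)) := by
    refine Metric.cauchy_iff.2 ⟨inferInstance, fun ε hε => ?_⟩
    -- The estimates below give `M * cA * ‖x p - x q‖ ^ 2 ≤ 12 * θ`; dividing by 13 makes the final
    -- inequality strict.
    set θ : ℝ := M * cA * ε ^ 2 / 13 with hθ
    have hθpos : 0 < θ := by positivity
    obtain ⟨ι, _, ℓ, hℓ⟩ := hcomp (θ * cA) (by positivity)
    have hlim : ∀ k, ∃ z, Tendsto (fun m => ℓ k (x m)) (hyperfilter ℕ : Filter ℕ) (𝓝 z) := by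
      intro k
      have hmem : ((hyperfilter ℕ).map fun m => ℓ k (x m) : Filter ℂ) ≤
          𝓟 (Metric.closedBall 0 (‖ℓ k‖ * Real.sqrt (1 / cA))) := by
        refine le_principal_iff.2 (Filter.mem_map.2 (Filter.Eventually.of_forall fun m => ?_))
        change ℓ k (x m) ∈ Metric.closedBall 0 _
        rw [mem_closedBall_zero_iff]
        exact ((ℓ k).le_opNorm _).trans
          (mul_le_mul_of_nonneg_left (Real.le_sqrt_of_sq_le (hnorm _ (hxA m))) (norm_nonneg _))
      obtain ⟨z, -, hz⟩ := (isCompact_closedBall (0 : ℂ) _).ultrafilter_le_nhds _ hmem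
      exact ⟨z, hz⟩
    choose z hz using hlim
    have hsum : Tendsto (fun m => ∑ k, ‖ℓ k (x m) - z k‖ ^ 2) (hyperfilter ℕ : Filter ℕ)
        (𝓝 0) := by
      have : Tendsto (fun m => ∑ k, ‖ℓ k (x m) - z k‖ ^ 2) (hyperfilter ℕ : Filter ℕ)
          (𝓝 (∑ k : ι, ‖z k - z k‖ ^ 2)) :=
        tendsto_finsetSum _ fun k _ => (((hz k).sub_const _).norm.pow 2)
      simpa using this
    have hev := (hsum.eventually (gt_mem_nhds hθpos)).and
      (hxS'.eventually (lt_mem_nhds (show M - θ < M by linarith)))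
    refine ⟨_, image_mem_map hev, ?_⟩
    rintro _ ⟨p, ⟨hp1, hp2⟩, rfl⟩ _ ⟨q, ⟨hq1, hq2⟩, rfl⟩
    have hpq : (S (x p - x q) (x p - x q)).re ≤ 8 * θ := by
      refine (hℓ _ (W.sub_mem (hxW p) (hxW q))).trans ?_
      have h1 : ‖x p - x q‖ ^ 2 ≤ 4 * (1 / cA) := by
        have hp := hnorm _ (hxA p)
        have hq := hnorm _ (hxA q)
        have := norm_sub_le (x p) (x q)
        nlinarith [norm_nonneg (x p - x q), sq_nonneg (‖x p‖ - ‖x q‖), norm_nonneg (x p),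
          norm_nonneg (x q)]
      have h2 : ∑ k, ‖ℓ k (x p - x q)‖ ^ 2 ≤
          2 * ∑ k, ‖ℓ k (x p) - z k‖ ^ 2 + 2 * ∑ k, ‖ℓ k (x q) - z k‖ ^ 2 := by
        rw [Finset.mul_sum, Finset.mul_sum, ← Finset.sum_add_distrib]
        refine Finset.sum_le_sum fun k _ => ?_
        have h3 : ℓ k (x p - x q) = (ℓ k (x p) - z k) - (ℓ k (x q) - z k) := by
          rw [map_sub]; ring
        rw [h3]
        have := norm_sub_le (ℓ k (x p) - z k) (ℓ k (x q) - z k)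
        nlinarith [norm_nonneg ((ℓ k (x p) - z k) - (ℓ k (x q) - z k)),
          sq_nonneg (‖ℓ k (x p) - z k‖ - ‖ℓ k (x q) - z k‖)]
      have h4 : θ * cA * ‖x p - x q‖ ^ 2 ≤ 4 * θ := by
        refine (mul_le_mul_of_nonneg_left h1 (by positivity)).trans (le_of_eq ?_)
        field_simp
      linarith
    -- Since `S (x p + x q) ≤ M * A (x p + x q) = M * (4 - A (x p - x q))` on the diagonal and both
    -- `S`-values exceed `M - θ`, the term `M * A (x p - x q)` is at most `4 * θ + S (x p - x q)`,
    -- which is at most `12 * θ`.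
    have hpar := hS.parallelogram (x p) (x q)
    have hparA := hA.parallelogram (x p) (x q)
    rw [hxA, hxA] at hparA
    have hadd := hle _ (W.add_mem (hxW p) (hxW q))
    have hlow := hA_lower (x p - x q)
    have hfin : M * cA * ‖x p - x q‖ ^ 2 ≤ 12 * θ := by
      have h5 : M * (cA * ‖x p - x q‖ ^ 2) ≤ M * (4 - (A (x p + x q) (x p + x q)).re) :=
        mul_le_mul_of_nonneg_left (by linarith) hMpos.le
      linarith
    have h6 : ‖x p - x q‖ ^ 2 < ε ^ 2 := by
      have h7 : M * cA * ‖x p - x q‖ ^ 2 < M * cA * ε ^ 2 := by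
        have : 13 * θ = M * cA * ε ^ 2 := by rw [hθ]; ring
        linarith
      exact lt_of_mul_lt_mul_left h7 (by positivity)
    rw [dist_eq_norm]
    exact lt_of_pow_lt_pow_left₀ 2 hε.le h6
  obtain ⟨w₀, hw₀⟩ := CompleteSpace.complete hCauchy
  have hw₀W : w₀ ∈ W := by
    refine hW.mem_of_tendsto (f := x) (b := (hyperfilter ℕ : Filter ℕ)) hw₀
      (Filter.Eventually.of_forall hxW)
  have hw₀A : (A w₀ w₀).re = 1 := by
    have h := ((hA.continuous_self hCA hA_upper).tendsto w₀).comp hw₀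
    refine tendsto_nhds_unique h ?_
    have : ((fun x => (A x x).re) ∘ x) = fun _ => (1 : ℝ) := funext hxA
    change Tendsto ((fun x => (A x x).re) ∘ x) (hyperfilter ℕ : Filter ℕ) _
    rw [this]
    exact tendsto_const_nhds
  have hw₀S : (S w₀ w₀).re = M :=
    tendsto_nhds_unique (((hS.continuous_self hCS hS_upper).tendsto w₀).comp hw₀) hxS'
  refine ⟨M, hMpos, hle, w₀, hw₀W, ?_, fun v hv => ?_⟩
  · rintro rfl
    simp [hA.zero_left] at hw₀A
  -- The form `M A - S` is nonnegative on `W` and vanishes on the diagonal at the maximizer, so the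
  -- maximizer lies in its radical.
  · have hF : IsHermForm fun p q : W => (M : ℂ) * A p q - S p q :=
      { add_left := fun p q t => by
          simp only [Submodule.coe_add, hA.add_left, hS.add_left]; ring
        smul_left := fun c p q => by
          simp only [Submodule.coe_smul, hA.smul_left, hS.smul_left]; ring
        conj_symm := fun p q => by
          simp only [map_sub, map_mul, Complex.conj_ofReal, hA.conj_symm, hS.conj_symm]
        nonneg := fun p => by
          have := hle p p.2
          simp only [Complex.sub_re, Complex.re_ofReal_mul]
          linarith }
    have h0 := hF.eq_zero_of_self_le (x := ⟨w₀, hw₀W⟩) (by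
      simp only [Complex.sub_re, Complex.re_ofReal_mul, hw₀A, hw₀S]
      linarith) ⟨v, hv⟩
    exact (sub_eq_zero.1 h0).symm

/-- The Riesz representation theorem for a bounded coercive Hermitian form on a closed subspace. -/
theorem exists_riesz_representative {X : Type*} [NormedAddCommGroup X] [NormedSpace ℂ X]
    [CompleteSpace X] {A : X → X → ℂ} (hA : IsHermForm A)
    {cA CA : ℝ} (hcA : 0 < cA) (hCA : 0 ≤ CA)
    (hA_lower : ∀ x, cA * ‖x‖ ^ 2 ≤ (A x x).re) (hA_upper : ∀ x, (A x x).re ≤ CA * ‖x‖ ^ 2)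
    (W : Submodule ℂ X) (hW : IsClosed (W : Set X)) (ℓ : X →L[ℂ] ℂ) :
    ∃ w ∈ W, ∀ v ∈ W, A w v = conj (ℓ v) := by
  by_cases h0 : ∀ w ∈ W, ℓ w = 0
  · exact ⟨0, W.zero_mem, fun v hv => by rw [hA.zero_left, h0 v hv, map_zero]⟩
  push Not at h0
  obtain ⟨w₁, hw₁, hw₁0⟩ := h0
  have hself : ∀ x, (ℓ x * conj (ℓ x)).re = ‖ℓ x‖ ^ 2 := fun x => by
    rw [Complex.mul_conj, Complex.normSq_eq_norm_sq, Complex.ofReal_re]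
  -- The representative is a rescaled Rayleigh maximizer of this rank-one form: `ℓ w₀ * conj (ℓ v) =
  -- M * A w₀ v`. Its compactness hypothesis holds with the single functional `ℓ`.
  have hS : IsHermForm fun x y => ℓ x * conj (ℓ y) :=
    { add_left := fun x y z => by rw [map_add, add_mul]
      smul_left := fun c x y => by rw [map_smul, smul_eq_mul, mul_assoc]
      conj_symm := fun x y => by simp [mul_comm]
      nonneg := fun x => by rw [hself]; positivity }
  obtain ⟨M, hM, -, w₀, hw₀, hw₀0, hw₀eq⟩ := exists_rayleigh_maximizer hA hS hcA hCA
    (CS := ‖ℓ‖ ^ 2) (by positivity) hA_lower hA_upper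
    (fun x => by
      rw [hself, ← mul_pow]
      exact pow_le_pow_left₀ (norm_nonneg _) (ℓ.le_opNorm x) 2) W hW
    (fun ε hε => ⟨Unit, inferInstance, fun _ => ℓ, fun w _ => by
      rw [hself]; simp only [Finset.univ_unique, Finset.sum_const, Finset.card_singleton, one_smul]
      nlinarith [sq_nonneg ‖w‖]⟩)
    ⟨w₁, hw₁, by rw [hself]; have := norm_pos_iff.2 hw₁0; positivity⟩
  have hℓ0 : ℓ w₀ ≠ 0 := by
    intro h
    have h1 := hw₀eq w₀ hw₀
    rw [h, zero_mul, hA.self_eq, ← Complex.ofReal_mul] at h1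
    have h2 : M * (A w₀ w₀).re = 0 := by exact_mod_cast h1.symm
    have h3 := hA_lower w₀
    have h4 : 0 < cA * ‖w₀‖ ^ 2 := by have := norm_pos_iff.2 hw₀0; positivity
    rcases mul_eq_zero.1 h2 with h5 | h5 <;> linarith
  refine ⟨((M : ℂ) / ℓ w₀) • w₀, W.smul_mem _ hw₀, fun v hv => ?_⟩
  rw [hA.smul_left, div_mul_eq_mul_div, ← hw₀eq v hv]
  field_simp

/-! ### The Poincaré inequality on convex sets -/

section Lintegral

variable {α : Type*} [MeasurableSpace α] {μ : Measure α}

lemma lintegral_mul_sq_le {f g : α → ℝ≥0∞} (hf : AEMeasurable f μ) (hg : AEMeasurable g μ) :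
    (∫⁻ x, f x * g x ∂μ) ^ 2 ≤ (∫⁻ x, f x ^ 2 ∂μ) * ∫⁻ x, g x ^ 2 ∂μ := by
  have h := ENNReal.lintegral_mul_le_Lp_mul_Lq μ (p := 2) (q := 2)
    (Real.holderConjugate_iff.2 ⟨by norm_num, by norm_num⟩) hf hg
  simp only [Pi.mul_apply, ENNReal.rpow_two] at h
  calc _ ≤ ((∫⁻ x, f x ^ 2 ∂μ) ^ (1 / 2 : ℝ) * (∫⁻ x, g x ^ 2 ∂μ) ^ (1 / 2 : ℝ)) ^ 2 := by gcongr
    _ = _ := by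
      rw [mul_pow, ← ENNReal.rpow_natCast, ← ENNReal.rpow_mul, ← ENNReal.rpow_natCast,
        ← ENNReal.rpow_mul]
      norm_num

lemma lintegral_sq_le {f : α → ℝ≥0∞} (hf : AEMeasurable f μ) :
    (∫⁻ x, f x ∂μ) ^ 2 ≤ μ Set.univ * ∫⁻ x, f x ^ 2 ∂μ := by
  simpa using lintegral_mul_sq_le (aemeasurable_const (b := (1 : ℝ≥0∞))) hf

/-- Jensen's inequality for the square and a weight. -/
lemma lintegral_weight_mul_sq_le {ρ f : α → ℝ≥0∞} (hρ : AEMeasurable ρ μ) (hf : AEMeasurable f μ) :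
    (∫⁻ x, ρ x * f x ∂μ) ^ 2 ≤ (∫⁻ x, ρ x ∂μ) * ∫⁻ x, ρ x * f x ^ 2 ∂μ := by
  have hs : ∀ x, ρ x = (ρ x ^ (1 / 2 : ℝ)) ^ 2 := fun x => by
    rw [← ENNReal.rpow_natCast, ← ENNReal.rpow_mul]; norm_num
  have h := lintegral_mul_sq_le (μ := μ) (f := fun x => ρ x ^ (1 / 2 : ℝ))
    (g := fun x => ρ x ^ (1 / 2 : ℝ) * f x) (hρ.pow_const _) ((hρ.pow_const _).mul hf)
  simp only [mul_pow, ← hs] at h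
  refine le_trans (le_of_eq ?_) h
  congr 1
  refine lintegral_congr fun x => ?_
  rw [← mul_assoc, ← sq, ← hs]

/-- By Tonelli both terms of the bound have the same double integral, so only one of them has to be
estimated. -/
lemma lintegral_lintegral_le_of_symm [SFinite μ] {q : α × α → ℝ≥0∞} (hq : Measurable q)
    {F : α → α → ℝ≥0∞} (hF : ∀ x y, F x y ≤ 2 * q (x, y) + 2 * q (y, x)) :
    ∫⁻ x, ∫⁻ y, F x y ∂μ ∂μ ≤ 4 * ∫⁻ y, ∫⁻ x, q (x, y) ∂μ ∂μ := by
  have hq' : Measurable fun p : α × α => q (p.2, p.1) := hq.comp measurable_swap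
  calc _ ≤ ∫⁻ x, ∫⁻ y, (2 * q (x, y) + 2 * q (y, x)) ∂μ ∂μ :=
        lintegral_mono fun x => lintegral_mono fun y => hF x y
    _ = ∫⁻ x, (2 * ∫⁻ y, q (x, y) ∂μ + 2 * ∫⁻ y, q (y, x) ∂μ) ∂μ := by
        refine lintegral_congr fun x => ?_
        have h1 : Measurable fun y => q (x, y) := hq.comp measurable_prodMk_left
        have h2 : Measurable fun y => q (y, x) := hq'.comp measurable_prodMk_left
        rw [lintegral_add_left (h1.const_mul 2), lintegral_const_mul _ h1,
          lintegral_const_mul _ h2]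
    _ = 2 * ∫⁻ x, ∫⁻ y, q (x, y) ∂μ ∂μ + 2 * ∫⁻ x, ∫⁻ y, q (y, x) ∂μ ∂μ := by
        have h1 : Measurable fun x => ∫⁻ y, q (x, y) ∂μ := hq.lintegral_prod_right'
        have h2 : Measurable fun x => ∫⁻ y, q (y, x) ∂μ := hq'.lintegral_prod_right'
        rw [lintegral_add_left (h1.const_mul 2), lintegral_const_mul _ h1,
          lintegral_const_mul _ h2]
    _ = _ := by
        rw [lintegral_lintegral_swap (f := fun x y => q (x, y)) hq.aemeasurable, ← add_mul]
        norm_num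

lemma add_sq_le_two_mul (a b : ℝ≥0∞) : (a + b) ^ 2 ≤ 2 * a ^ 2 + 2 * b ^ 2 := by
  rcases eq_or_ne a ∞ with rfl | ha
  · simp [ENNReal.mul_top]
  rcases eq_or_ne b ∞ with rfl | hb
  · simp [ENNReal.mul_top]
  lift a to NNReal using ha
  lift b to NNReal using hb
  norm_cast
  exact_mod_cast (show ((a : ℝ) + b) ^ 2 ≤ 2 * a ^ 2 + 2 * b ^ 2 by
    nlinarith [sq_nonneg ((a : ℝ) - b)])

end Lintegral

variable {d : ℕ}

lemma lintegral_comp_homothety {F : E d → ℝ≥0∞} (hF : Measurable F) (y : E d) {t : ℝ}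
    (ht : t ≠ 0) :
    ∫⁻ x, F (y + t • (x - y)) = ENNReal.ofReal |(t ^ d)⁻¹| * ∫⁻ x, F x := by
  rw [lintegral_sub_right_eq_self (μ := (volume : Measure (E d))) (fun x => F (y + t • x)) y]
  rw [← lintegral_add_left_eq_self (μ := (volume : Measure (E d))) F y]
  rw [← lintegral_map (f := fun z => F (y + z)) (g := fun x : E d => t • x)
    (hF.comp (measurable_const_add y)) (measurable_const_smul t)]
  rw [Measure.map_addHaar_smul volume ht, lintegral_smul_measure]
  simp

/-- Convexity keeps the contracted point in `P`, and the Jacobian factor `t⁻ᵈ` is at most `2 ^ d`.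
The restriction to `t ≥ 1/2` avoids its singularity at `t = 0`. -/
lemma setLIntegral_comp_homothety_le {P : Set (E d)} (hP : Convex ℝ P) (hPm : MeasurableSet P)
    {F : E d → ℝ≥0∞} (hF : Measurable F) {y : E d} (hy : y ∈ P) {t : ℝ}
    (ht : t ∈ Set.Icc (1 / 2 : ℝ) 1) :
    ∫⁻ x in P, F (y + t • (x - y)) ≤ 2 ^ d * ∫⁻ x in P, F x := by
  have ht0 : 0 < t := by linarith [ht.1]
  calc ∫⁻ x in P, F (y + t • (x - y)) = ∫⁻ x in P, P.indicator F (y + t • (x - y)) := by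
        refine setLIntegral_congr_fun hPm fun x hx => ?_
        rw [Set.indicator_of_mem]
        exact hP.add_smul_sub_mem hy hx ⟨ht0.le, ht.2⟩
    _ ≤ ∫⁻ x, P.indicator F (y + t • (x - y)) := setLIntegral_le_lintegral _ _
    _ = ENNReal.ofReal |(t ^ d)⁻¹| * ∫⁻ x, P.indicator F x :=
        lintegral_comp_homothety (hF.indicator hPm) y ht0.ne'
    _ ≤ 2 ^ d * ∫⁻ x in P, F x := by
        rw [lintegral_indicator hPm]
        gcongr
        rw [abs_of_pos (by positivity), ← inv_pow, ENNReal.ofReal_pow (by positivity)]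
        gcongr
        refine ENNReal.ofReal_le_of_le_toReal ?_
        rw [ENNReal.toReal_ofNat, inv_le_comm₀ ht0 two_pos]
        linarith [ht.1]

/-- The fundamental theorem of calculus on the half segment from the midpoint to `x`, followed by
Cauchy-Schwarz in `t`. Only `t ≥ 1/2` occurs, as the change of variables requires. -/
lemma enorm_sub_midpoint_sq_le {v : E d → ℂ} (hv : ContDiff ℝ 1 v) {h : ℝ} {x y : E d}
    (hxy : ‖x - y‖ ≤ h) :
    ‖v x - v (y + (1 / 2 : ℝ) • (x - y))‖ₑ ^ 2 ≤ ENNReal.ofReal h ^ 2 *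
      ∫⁻ t in Set.Icc (1 / 2 : ℝ) 1, ‖fderiv ℝ v (y + t • (x - y))‖ₑ ^ 2 := by
  have hd : ∀ t : ℝ, HasDerivAt (fun t : ℝ => v (y + t • (x - y)))
      (fderiv ℝ v (y + t • (x - y)) (x - y)) t := fun t => by
    have h1 : HasDerivAt (fun t : ℝ => y + t • (x - y)) (x - y) t := by
      simpa using ((hasDerivAt_id t).smul_const (x - y)).const_add y
    exact ((hv.differentiable one_ne_zero _).hasFDerivAt).comp_hasDerivAt t h1
  have hc : Continuous fun t : ℝ => fderiv ℝ v (y + t • (x - y)) :=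
    (hv.continuous_fderiv one_ne_zero).comp (by fun_prop)
  have hftc := intervalIntegral.integral_eq_sub_of_hasDerivAt (a := 1 / 2) (b := 1)
    (fun t _ => hd t) ((hc.clm_apply continuous_const).intervalIntegrable _ _)
  have hint : v x - v (y + (1 / 2 : ℝ) • (x - y)) =
      ∫ t in Set.Icc (1 / 2 : ℝ) 1, fderiv ℝ v (y + t • (x - y)) (x - y) := by
    rw [integral_Icc_eq_integral_Ioc, ← intervalIntegral.integral_of_le (by norm_num), hftc]
    simp
  have hle : ‖v x - v (y + (1 / 2 : ℝ) • (x - y))‖ₑ ≤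
      ∫⁻ t in Set.Icc (1 / 2 : ℝ) 1, ENNReal.ofReal h * ‖fderiv ℝ v (y + t • (x - y))‖ₑ := by
    rw [hint]
    refine (enorm_integral_le_lintegral_enorm _).trans (lintegral_mono fun t => ?_)
    rw [mul_comm]
    refine (ContinuousLinearMap.le_opENorm _ _).trans ?_
    gcongr
    rw [← ofReal_norm]
    exact ENNReal.ofReal_le_ofReal hxy
  refine (pow_le_pow_left' hle 2).trans ?_
  rw [lintegral_const_mul _ hc.enorm.measurable, mul_pow]
  gcongr
  refine (lintegral_sq_le hc.enorm.measurable.aemeasurable).trans ?_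
  refine mul_le_of_le_one_left' ?_
  simp only [Measure.restrict_apply_univ, Real.volume_Icc]
  exact ENNReal.ofReal_le_one.2 (by norm_num)

/-- The Poincaré inequality in double integral form, for smooth functions. -/
theorem lintegral_sub_sq_le_of_contDiff {v : E d → ℂ} (hv : ContDiff ℝ 1 v) {P : Set (E d)}
    (hP : Convex ℝ P) (hPm : MeasurableSet P) {h : ℝ} (hh : ∀ x ∈ P, ∀ y ∈ P, ‖x - y‖ ≤ h) :
    ∫⁻ x in P, ∫⁻ y in P, ‖v x - v y‖ₑ ^ 2 ≤
      4 * (ENNReal.ofReal h ^ 2 * 2 ^ d) * volume P * ∫⁻ x in P, ‖fderiv ℝ v x‖ₑ ^ 2 := by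
  set D : ℝ≥0∞ := ∫⁻ x in P, ‖fderiv ℝ v x‖ₑ ^ 2 with hD
  have hcv := hv.continuous
  have hcd : Continuous fun x => ‖fderiv ℝ v x‖ₑ ^ 2 :=
    (ENNReal.continuous_pow 2).comp (hv.continuous_fderiv one_ne_zero).enorm
  have hhalf : ∀ y ∈ P, ∫⁻ x in P, ‖v x - v (y + (1 / 2 : ℝ) • (x - y))‖ₑ ^ 2 ≤
      ENNReal.ofReal h ^ 2 * 2 ^ d * D := by
    intro y hy
    calc _ ≤ ∫⁻ x in P, ENNReal.ofReal h ^ 2 *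
          ∫⁻ t in Set.Icc (1 / 2 : ℝ) 1, ‖fderiv ℝ v (y + t • (x - y))‖ₑ ^ 2 :=
          setLIntegral_mono' hPm fun x hx => enorm_sub_midpoint_sq_le hv (hh x hx y hy)
      _ = ENNReal.ofReal h ^ 2 * ∫⁻ x in P,
          ∫⁻ t in Set.Icc (1 / 2 : ℝ) 1, ‖fderiv ℝ v (y + t • (x - y))‖ₑ ^ 2 :=
          lintegral_const_mul' _ _ (ENNReal.pow_ne_top ENNReal.ofReal_ne_top)
      _ = ENNReal.ofReal h ^ 2 * ∫⁻ t in Set.Icc (1 / 2 : ℝ) 1,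
          ∫⁻ x in P, ‖fderiv ℝ v (y + t • (x - y))‖ₑ ^ 2 := by
          rw [lintegral_lintegral_swap]
          exact (hcd.comp (by fun_prop :
            Continuous fun p : E d × ℝ => y + p.2 • (p.1 - y))).measurable.aemeasurable
      _ ≤ ENNReal.ofReal h ^ 2 * ∫⁻ t in Set.Icc (1 / 2 : ℝ) 1, 2 ^ d * D := by
          refine mul_le_mul_right ?_ _
          exact setLIntegral_mono' measurableSet_Icc fun t ht =>
            setLIntegral_comp_homothety_le hP hPm hcd.measurable hy ht
      _ ≤ ENNReal.ofReal h ^ 2 * (2 ^ d * D) := by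
          gcongr
          rw [setLIntegral_const, Real.volume_Icc]
          refine mul_le_of_le_one_right' ?_
          exact ENNReal.ofReal_le_one.2 (by norm_num)
      _ = _ := by rw [mul_assoc]
  have hmeas : Measurable fun p : E d × E d =>
      ‖v p.1 - v (p.2 + (1 / 2 : ℝ) • (p.1 - p.2))‖ₑ ^ 2 := by
    refine Continuous.measurable ((ENNReal.continuous_pow 2).comp (Continuous.enorm ?_))
    exact (hcv.comp continuous_fst).sub (hcv.comp (by fun_prop))
  have hA : ∫⁻ y in P, ∫⁻ x in P, ‖v x - v (y + (1 / 2 : ℝ) • (x - y))‖ₑ ^ 2 ≤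
      ENNReal.ofReal h ^ 2 * 2 ^ d * D * volume P :=
    (setLIntegral_mono' hPm hhalf).trans (setLIntegral_const _ _).le
  -- The midpoint is symmetric in `x` and `y`, so passing through it splits `v x - v y` into two
  -- differences of the same type with the variables exchanged.
  have hsymm : ∀ x y : E d, y + (1 / 2 : ℝ) • (x - y) = x + (1 / 2 : ℝ) • (y - x) := fun x y => by
    module
  calc ∫⁻ x in P, ∫⁻ y in P, ‖v x - v y‖ₑ ^ 2
      ≤ 4 * ∫⁻ y in P, ∫⁻ x in P, ‖v x - v (y + (1 / 2 : ℝ) • (x - y))‖ₑ ^ 2 := by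
        refine lintegral_lintegral_le_of_symm hmeas fun x y => ?_
        refine le_trans (pow_le_pow_left' ?_ 2) (add_sq_le_two_mul _ _)
        rw [← hsymm x y]
        have : v x - v y = (v x - v (y + (1 / 2 : ℝ) • (x - y))) -
          (v y - v (y + (1 / 2 : ℝ) • (x - y))) := by ring
        rw [this]
        exact enorm_sub_le
    _ ≤ 4 * (ENNReal.ofReal h ^ 2 * 2 ^ d * D * volume P) := by gcongr
    _ = _ := by ring

end CEM

namespace CEM

open Filter Topology ComplexConjugate
open scoped ENNReal Pointwise Convolution

variable {d : ℕ}

/-! ### Mollification and the Poincaré inequality for Sobolev functions -/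

/-- Mollification by a bump function. -/
noncomputable def mollify {F : Type*} [NormedAddCommGroup F] [NormedSpace ℝ F]
    (ρ : ContDiffBump (0 : E d)) (g : E d → F) : E d → F :=
  ρ.normed volume ⋆[ContinuousLinearMap.lsmul ℝ ℝ, volume] g

lemma mollify_apply {F : Type*} [NormedAddCommGroup F] [NormedSpace ℝ F]
    (ρ : ContDiffBump (0 : E d)) (g : E d → F) (x : E d) :
    mollify ρ g x = ∫ t, ρ.normed volume (x - t) • g t := by
  rw [mollify, convolution_eq_swap]
  rfl

lemma contDiff_mollify {g : E d → ℂ} (ρ : ContDiffBump (0 : E d)) (hg : LocallyIntegrable g) :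
    ContDiff ℝ 1 (mollify ρ g) :=
  ρ.hasCompactSupport_normed.contDiff_convolution_left (n := 1) _ ρ.contDiff_normed hg

lemma fderiv_mollify {g : E d → ℂ} (ρ : ContDiffBump (0 : E d)) (hg : LocallyIntegrable g)
    (x e : E d) :
    fderiv ℝ (mollify ρ g) x e = ∫ t, fderiv ℝ (ρ.normed volume) (x - t) e • g t := by
  have hc : ContDiff ℝ 1 (ρ.normed (volume : Measure (E d))) := ρ.contDiff_normed (n := 1)
  have h := ρ.hasCompactSupport_normed.hasFDerivAt_convolution_left
    (ContinuousLinearMap.lsmul ℝ ℝ) hc hg x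
  rw [mollify, h.fderiv, convolution_eq_swap, ContinuousLinearMap.integral_apply]
  · rfl
  · have hex := (ρ.hasCompactSupport_normed.fderiv (𝕜 := ℝ)).convolutionExists_left
      ((ContinuousLinearMap.lsmul ℝ ℝ).precompL (E d)) (hc.continuous_fderiv one_ne_zero) hg x
    exact (convolutionExistsAt_iff_integrable_swap).1 hex

lemma enorm_mollify_le {F : Type*} [NormedAddCommGroup F] [NormedSpace ℝ F]
    (ρ : ContDiffBump (0 : E d)) (g : E d → F) (x : E d) :
    ‖mollify ρ g x‖ₑ ≤ ∫⁻ t, ENNReal.ofReal (ρ.normed volume (x - t)) * ‖g t‖ₑ := by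
  rw [mollify_apply]
  refine (enorm_integral_le_lintegral_enorm _).trans (lintegral_mono fun t => ?_)
  rw [enorm_smul, Real.enorm_of_nonneg (ρ.nonneg_normed _)]

lemma lintegral_normed (ρ : ContDiffBump (0 : E d)) :
    ∫⁻ t, ENNReal.ofReal (ρ.normed volume t) = 1 := by
  rw [← ofReal_integral_eq_lintegral_ofReal ρ.integrable_normed
    (Eventually.of_forall ρ.nonneg_normed), ρ.integral_normed, ENNReal.ofReal_one]

/-- Schur's test for a doubly stochastic kernel. -/
lemma lintegral_kernel_sq_le {α : Type*} [MeasurableSpace α] {μ : Measure α} [SFinite μ]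
    {k : α × α → ℝ≥0∞} (hk : Measurable k) (h1 : ∀ x, ∫⁻ t, k (x, t) ∂μ = 1)
    (h2 : ∀ t, ∫⁻ x, k (x, t) ∂μ = 1) {g : α → ℝ≥0∞} (hg : Measurable g) :
    ∫⁻ x, (∫⁻ t, k (x, t) * g t ∂μ) ^ 2 ∂μ ≤ ∫⁻ x, g x ^ 2 ∂μ := by
  have hg2 : Measurable fun p : α × α => g p.2 ^ 2 := (hg.pow_const 2).comp measurable_snd
  have hm : Measurable fun p : α × α => k p * g p.2 ^ 2 := hk.mul hg2
  calc ∫⁻ x, (∫⁻ t, k (x, t) * g t ∂μ) ^ 2 ∂μ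
      ≤ ∫⁻ x, ∫⁻ t, k (x, t) * g t ^ 2 ∂μ ∂μ := by
        refine lintegral_mono fun x => ?_
        have hkx : Measurable fun t => k (x, t) := hk.comp measurable_prodMk_left
        refine (lintegral_weight_mul_sq_le hkx.aemeasurable hg.aemeasurable).trans ?_
        rw [h1, one_mul]
    _ = ∫⁻ t, ∫⁻ x, k (x, t) * g t ^ 2 ∂μ ∂μ :=
        lintegral_lintegral_swap (f := fun x t => k (x, t) * g t ^ 2) hm.aemeasurable
    _ = _ := by
        refine lintegral_congr fun t => ?_
        have hkt : Measurable fun x => k (x, t) := hk.comp measurable_prodMk_right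
        rw [lintegral_mul_const _ hkt, h2, one_mul]

/-- Mollification does not increase the `L²` norm. -/
lemma lintegral_mollify_sq_le {F : Type*} [NormedAddCommGroup F] [NormedSpace ℝ F]
    (ρ : ContDiffBump (0 : E d)) {g : E d → F} (hg : StronglyMeasurable g) :
    ∫⁻ x, ‖mollify ρ g x‖ₑ ^ 2 ≤ ∫⁻ x, ‖g x‖ₑ ^ 2 := by
  have hρ : Measurable fun t => ENNReal.ofReal (ρ.normed (volume : Measure (E d)) t) :=
    ρ.continuous_normed.measurable.ennreal_ofReal
  refine (lintegral_mono fun x => pow_le_pow_left' (enorm_mollify_le ρ g x) 2).trans ?_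
  refine lintegral_kernel_sq_le
    (k := fun p => ENNReal.ofReal (ρ.normed (volume : Measure (E d)) (p.1 - p.2)))
    (hρ.comp (measurable_fst.sub measurable_snd)) (fun x => ?_) (fun t => ?_) hg.enorm
  · rw [lintegral_sub_left_eq_self (fun t => ENNReal.ofReal (ρ.normed volume t)) x,
      lintegral_normed]
  · rw [lintegral_sub_right_eq_self (fun t => ENNReal.ofReal (ρ.normed volume t)) t,
      lintegral_normed]

lemma fst_memLp {U : Set (E d)} (w : Pair U) : MemLp w.fst 2 (volume.restrict U) := Lp.memLp _

lemma snd_memLp {U : Set (E d)} (w : Pair U) : MemLp w.snd 2 (volume.restrict U) := Lp.memLp _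

lemma integrable_indicator_of_memLp {F : Type*} [NormedAddCommGroup F] {P : Set (E d)}
    (hPm : MeasurableSet P) (hfin : volume P ≠ ∞) {g : E d → F}
    (hg : MemLp g 2 (volume.restrict P)) : Integrable (P.indicator g) := by
  have : IsFiniteMeasure (volume.restrict P) := ⟨by simpa using hfin.lt_top⟩
  exact (integrable_indicator_iff hPm).2 (hg.integrable (by norm_num))

/-- The gradient of the mollification is the mollification of the weak gradient. -/
lemma fderiv_mollify_eq {P : Set (E d)} (hPm : MeasurableSet P) (hfin : volume P ≠ ∞)
    {w : Pair P} (hw : w ∈ H1 P) (ρ : ContDiffBump (0 : E d)) {x : E d}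
    (hx : Metric.closedBall x ρ.rOut ⊆ P) (i : Fin d) :
    fderiv ℝ (mollify ρ (P.indicator w.fst)) x (EuclideanSpace.single i 1) =
      mollify ρ (P.indicator w.snd) x i := by
  -- The reflected, translated bump is an admissible test function because its support lies in the
  -- ball around `x`. The sign from the reflection cancels the sign from integration by parts.
  set η : E d → ℝ := fun t => ρ.normed volume (x - t) with hη
  have hηc : ContDiff ℝ (⊤ : ℕ∞) η := by
    have : ContDiff ℝ (⊤ : ℕ∞) (ρ.normed (volume : Measure (E d))) := ρ.contDiff_normed
    exact this.comp (contDiff_const.sub contDiff_id)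
  have hηsupp : tsupport η ⊆ Metric.closedBall x ρ.rOut := by
    refine closure_minimal (fun t ht => ?_) Metric.isClosed_closedBall
    have h1 : x - t ∈ Function.support (ρ.normed (volume : Measure (E d))) := ht
    rw [ρ.support_normed_eq, mem_ball_zero_iff] at h1
    rw [Metric.mem_closedBall, dist_comm, dist_eq_norm]
    exact h1.le
  have hηcpt : HasCompactSupport η :=
    (isCompact_closedBall x ρ.rOut).of_isClosed_subset (isClosed_tsupport _) hηsupp
  have hηd : ∀ t, fderiv ℝ η t (EuclideanSpace.single i 1) =
      -fderiv ℝ (ρ.normed volume) (x - t) (EuclideanSpace.single i 1) := fun t => by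
    have hd : HasFDerivAt (ρ.normed (volume : Measure (E d)))
        (fderiv ℝ (ρ.normed volume) (x - t)) (x - t) :=
      ((ρ.contDiff_normed (n := 1)).differentiable one_ne_zero _).hasFDerivAt
    have h2 : HasFDerivAt (fun t : E d => x - t) (-ContinuousLinearMap.id ℝ (E d)) t :=
      (hasFDerivAt_id t).const_sub x
    have h3 : HasFDerivAt η _ t := hd.comp t h2
    rw [h3.fderiv]
    simp
  have hibp := hw η hηc hηcpt (hηsupp.trans hx) i
  have hUint := integrable_indicator_of_memLp hPm hfin (fst_memLp w)
  have hGint := integrable_indicator_of_memLp hPm hfin (snd_memLp w)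
  rw [fderiv_mollify ρ hUint.locallyIntegrable, mollify_apply]
  have hcoord : (∫ t, ρ.normed volume (x - t) • P.indicator w.snd t) i =
      ∫ t, (ρ.normed volume (x - t) • P.indicator w.snd t) i := by
    refine ((EuclideanSpace.proj i : EuclideanSpace ℂ (Fin d) →L[ℂ] ℂ).integral_comp_comm ?_).symm
    have h := (ρ.hasCompactSupport_normed (μ := (volume : Measure (E d)))).convolutionExists_left
      (ContinuousLinearMap.lsmul ℝ ℝ) ρ.continuous_normed hGint.locallyIntegrable x
    exact (convolutionExistsAt_iff_integrable_swap).1 h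
  rw [hcoord]
  have h1 : ∫ t, fderiv ℝ (ρ.normed volume) (x - t) (EuclideanSpace.single i 1) •
      P.indicator w.fst t = -∫ t in P, ((fderiv ℝ η t (EuclideanSpace.single i 1) : ℝ) : ℂ) *
        w.fst t := by
    rw [← integral_neg, ← integral_indicator hPm]
    refine integral_congr_ae (Eventually.of_forall fun t => ?_)
    by_cases ht : t ∈ P
    · simp [ht, hηd]
    · simp [ht]
  have h2 : ∫ t, (ρ.normed volume (x - t) • P.indicator w.snd t) i =
      ∫ t in P, (η t : ℂ) * (w.snd t) i := by
    rw [← integral_indicator hPm]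
    refine integral_congr_ae (Eventually.of_forall fun t => ?_)
    by_cases ht : t ∈ P
    · simp [ht, hη]
    · simp [ht]
  rw [h1, h2, hibp, neg_neg]

/-- Cauchy-Schwarz over the coordinates. It compares the operator norm of the derivative, used for
smooth functions, with the Euclidean norm of the weak gradient, without a dimensional factor. -/
lemma opNorm_le_of_apply_single {L : E d →L[ℝ] ℂ} {g : EuclideanSpace ℂ (Fin d)}
    (h : ∀ i, L (EuclideanSpace.single i 1) = g i) : ‖L‖ ≤ ‖g‖ := by
  refine L.opNorm_le_bound (norm_nonneg _) fun y => ?_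
  have hy : L y = ∑ i, (y i : ℂ) * g i := by
    conv_lhs => rw [← (EuclideanSpace.basisFun (Fin d) ℝ).sum_repr y]
    simp [h]
  rw [hy, EuclideanSpace.norm_eq, EuclideanSpace.norm_eq, ← Real.sqrt_mul (by positivity)]
  refine Real.le_sqrt_of_sq_le ?_
  calc ‖∑ i, (y i : ℂ) * g i‖ ^ 2 ≤ (∑ i, ‖y i‖ * ‖g i‖) ^ 2 := by
        gcongr
        refine (norm_sum_le _ _).trans (le_of_eq ?_)
        simp
    _ ≤ _ := by
        rw [mul_comm]
        exact Finset.sum_mul_sq_le_sq_mul_sq _ _ _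

/-- The complement is the Minkowski sum of the closed set `Pᶜ` and a compact ball, hence closed. -/
lemma isOpen_setOf_closedBall_subset {P : Set (E d)} (hP : IsOpen P) (r : ℝ) :
    IsOpen {x | Metric.closedBall x r ⊆ P} := by
  have h : {x | Metric.closedBall x r ⊆ P}ᶜ = Pᶜ + Metric.closedBall (0 : E d) r := by
    ext x
    simp only [Set.mem_compl_iff, Set.mem_ofPred_eq, Set.not_subset, Set.mem_add]
    constructor
    · rintro ⟨y, hy, hyP⟩
      refine ⟨y, hyP, x - y, ?_, by abel⟩
      rwa [mem_closedBall_zero_iff, ← dist_eq_norm, dist_comm]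
    · rintro ⟨y, hyP, z, hz, rfl⟩
      refine ⟨y, ?_, hyP⟩
      rw [mem_closedBall_zero_iff] at hz
      simpa [dist_eq_norm] using hz
  rw [← isClosed_compl_iff, h]
  exact (isClosed_compl_iff.2 hP).add_right_of_isCompact (isCompact_closedBall _ _)

/-- A point of the ball around `a • x + b • y` is the same convex combination of points of the two
balls, each shifted by the same vector. -/
lemma convex_setOf_closedBall_subset {P : Set (E d)} (hP : Convex ℝ P) (r : ℝ) :
    Convex ℝ {x | Metric.closedBall x r ⊆ P} := by
  intro x hx y hy a b ha hb hab z hz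
  have h : z = a • (x + (z - (a • x + b • y))) + b • (y + (z - (a • x + b • y))) := by
    have : a • (z - (a • x + b • y)) + b • (z - (a • x + b • y)) = z - (a • x + b • y) := by
      rw [← add_smul, hab, one_smul]
    rw [smul_add, smul_add, add_add_add_comm, this]
    abel
  have hz' : ‖z - (a • x + b • y)‖ ≤ r := by rwa [← dist_eq_norm]
  rw [h]
  exact hP (hx (by simpa [dist_eq_norm] using hz')) (hy (by simpa [dist_eq_norm] using hz')) ha hb
    hab

/-- The Poincaré inequality in double integral form on an open convex set. -/
theorem H1.lintegral_sub_sq_le {P : Set (E d)} (hPo : IsOpen P) (hP : Convex ℝ P)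
    (hfin : volume P ≠ ∞) {h : ℝ} (hh : ∀ x ∈ P, ∀ y ∈ P, ‖x - y‖ ≤ h) {w : Pair P}
    (hw : w ∈ H1 P) :
    ∫⁻ x in P, ∫⁻ y in P, ‖w.fst x - w.fst y‖ₑ ^ 2 ≤
      4 * (ENNReal.ofReal h ^ 2 * 2 ^ d) * volume P * ∫⁻ x in P, ‖w.snd x‖ₑ ^ 2 := by
  -- The outer radius is twice the inner one; this bounded ratio is what almost everywhere
  -- convergence of the mollifications requires.
  let ρ : ℕ → ContDiffBump (0 : E d) := fun n =>
    ⟨1 / ((n : ℝ) + 1) / 2, 1 / ((n : ℝ) + 1), by positivity, half_lt_self (by positivity)⟩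
  have hPm := hPo.measurableSet
  have hU : Integrable (P.indicator w.fst) := integrable_indicator_of_memLp hPm hfin (fst_memLp w)
  set v : ℕ → E d → ℂ := fun n => mollify (ρ n) (P.indicator w.fst) with hv
  have hvc : ∀ n, ContDiff ℝ 1 (v n) := fun n => contDiff_mollify _ hU.locallyIntegrable
  have hrlim : Tendsto (fun n => (ρ n).rOut) atTop (𝓝 0) := tendsto_one_div_add_atTop_nhds_zero_nat
  have hlim : ∀ᵐ x : E d, Tendsto (fun n => v n x) atTop (𝓝 (P.indicator w.fst x)) :=
    ContDiffBump.ae_convolution_tendsto_right_of_locallyIntegrable (K := 2) hrlim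
      (Eventually.of_forall fun n => by
        change 1 / ((n : ℝ) + 1) ≤ 2 * (1 / ((n : ℝ) + 1) / 2)
        linarith) hU.locallyIntegrable
  -- On `Q n` the mollified function has the mollified weak gradient as its gradient. These sets are
  -- convex, so the smooth inequality applies on them, and every point of `P` belongs to all but
  -- finitely many.
  set Q : ℕ → Set (E d) := fun n => {x | Metric.closedBall x (ρ n).rOut ⊆ P} with hQ
  have hQm : ∀ n, MeasurableSet (Q n) := fun n =>
    (isOpen_setOf_closedBall_subset hPo _).measurableSet
  have hQP : ∀ n, Q n ⊆ P := fun n x hx => hx (Metric.mem_closedBall_self (ρ n).rOut_pos.le)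
  have hQev : ∀ x ∈ P, ∀ᶠ n in atTop, x ∈ Q n := by
    intro x hx
    obtain ⟨r, hr, hrP⟩ := Metric.isOpen_iff.1 hPo x hx
    filter_upwards [hrlim.eventually (gt_mem_nhds hr)] with n hn
    exact (Metric.closedBall_subset_ball hn).trans hrP
  set q : ℕ → E d → E d → ℝ≥0∞ := fun n x y => ‖v n x - v n y‖ₑ ^ 2 with hq
  have hqm : ∀ n, Measurable fun p : E d × E d => q n p.1 p.2 := fun n =>
    ((ENNReal.continuous_pow 2).comp
      ((hvc n).continuous.comp continuous_fst |>.sub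
        ((hvc n).continuous.comp continuous_snd)).enorm).measurable
  set F : ℕ → E d → E d → ℝ≥0∞ := fun n x y =>
    (Q n).indicator (fun x => (Q n).indicator (fun y => q n x y) y) x with hF
  have hFint : ∀ n x, ∫⁻ y, F n x y = (Q n).indicator (fun x => ∫⁻ y in Q n, q n x y) x := by
    intro n x
    by_cases hx : x ∈ Q n
    · simp only [hF, Set.indicator_of_mem hx]
      exact lintegral_indicator (hQm n) _
    · simp [hF, Set.indicator_of_notMem hx]
  have hqm' : ∀ n, Measurable fun x => ∫⁻ y in Q n, q n x y := fun n =>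
    (hqm n).lintegral_prod_right'
  have hbound : ∀ n, ∫⁻ x, ∫⁻ y, F n x y ≤
      4 * (ENNReal.ofReal h ^ 2 * 2 ^ d) * volume P * ∫⁻ x in P, ‖w.snd x‖ₑ ^ 2 := by
    intro n
    simp only [hFint]
    rw [lintegral_indicator (hQm n)]
    refine (lintegral_sub_sq_le_of_contDiff (hvc n) (convex_setOf_closedBall_subset hP _) (hQm n)
      fun x hx y hy => hh x (hQP n hx) y (hQP n hy)).trans ?_
    gcongr ?_ * ?_
    · gcongr
      exact hQP n
    · calc ∫⁻ x in Q n, ‖fderiv ℝ (v n) x‖ₑ ^ 2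
          ≤ ∫⁻ x in Q n, ‖mollify (ρ n) (P.indicator w.snd) x‖ₑ ^ 2 := by
            refine setLIntegral_mono' (hQm n) fun x hx => ?_
            refine pow_le_pow_left' (enorm_le_iff_norm_le.2 ?_) 2
            exact opNorm_le_of_apply_single fun i => fderiv_mollify_eq hPm hfin hw (ρ n) hx i
        _ ≤ ∫⁻ x, ‖mollify (ρ n) (P.indicator w.snd) x‖ₑ ^ 2 := setLIntegral_le_lintegral _ _
        _ ≤ ∫⁻ x, ‖P.indicator w.snd x‖ₑ ^ 2 :=
            lintegral_mollify_sq_le _ ((Lp.stronglyMeasurable _).indicator hPm)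
        _ = _ := by
            rw [← lintegral_indicator hPm]
            refine lintegral_congr fun x => ?_
            by_cases hx : x ∈ P <;> simp [hx]
  -- Fatou's lemma in each variable. The constant survives because mollification does not increase
  -- the norm of the gradient.
  calc ∫⁻ x in P, ∫⁻ y in P, ‖w.fst x - w.fst y‖ₑ ^ 2
      ≤ ∫⁻ x in P, ∫⁻ y in P, liminf (fun n => F n x y) atTop := by
        refine lintegral_mono_ae ?_
        filter_upwards [ae_restrict_mem hPm, ae_restrict_of_ae hlim] with x hx hxl
        refine lintegral_mono_ae ?_
        filter_upwards [ae_restrict_mem hPm, ae_restrict_of_ae hlim] with y hy hyl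
        rw [Set.indicator_of_mem hx] at hxl
        rw [Set.indicator_of_mem hy] at hyl
        have ht : Tendsto (fun n => F n x y) atTop (𝓝 (‖w.fst x - w.fst y‖ₑ ^ 2)) := by
          have h1 : Tendsto (fun n => q n x y) atTop (𝓝 (‖w.fst x - w.fst y‖ₑ ^ 2)) :=
            ((ENNReal.continuous_pow 2).tendsto _).comp ((hxl.sub hyl).enorm)
          refine h1.congr' ?_
          filter_upwards [hQev x hx, hQev y hy] with n hn1 hn2
          simp [hF, hn1, hn2]
        exact ht.liminf_eq.ge
    _ ≤ ∫⁻ x, ∫⁻ y, liminf (fun n => F n x y) atTop := by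
        refine (setLIntegral_le_lintegral _ _).trans (lintegral_mono fun x => ?_)
        exact setLIntegral_le_lintegral _ _
    _ ≤ ∫⁻ x, liminf (fun n => ∫⁻ y, F n x y) atTop := by
        refine lintegral_mono fun x => lintegral_liminf_le fun n => ?_
        by_cases hx : x ∈ Q n
        · simp only [hF, Set.indicator_of_mem hx]
          exact ((hqm n).comp measurable_prodMk_left).indicator (hQm n)
        · simp [hF, Set.indicator_of_notMem hx]
    _ ≤ liminf (fun n => ∫⁻ x, ∫⁻ y, F n x y) atTop := by
        refine lintegral_liminf_le fun n => ?_
        simp only [hFint]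
        exact (hqm' n).indicator (hQm n)
    _ ≤ _ := by
        refine (liminf_le_liminf (Eventually.of_forall hbound)).trans ?_
        rw [liminf_const]

end CEM

namespace CEM

open Filter Topology ComplexConjugate
open scoped ENNReal

variable {d : ℕ}

/-! ### Restriction to subsets and Rellich compactness -/

/-- The restriction of a Sobolev function to a subset. -/
noncomputable def restrictPair {U U' : Set (E d)} (h : U' ⊆ U) (w : Pair U) : Pair U' :=
  WithLp.toLp 2 (((fst_memLp w).mono_measure (Measure.restrict_mono_set volume h)).toLp,
    ((snd_memLp w).mono_measure (Measure.restrict_mono_set volume h)).toLp)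

lemma restrictPair_fst {U U' : Set (E d)} (h : U' ⊆ U) (w : Pair U) :
    (restrictPair h w).fst =ᵐ[volume.restrict U'] w.fst :=
  ((fst_memLp w).mono_measure (Measure.restrict_mono_set volume h)).coeFn_toLp

lemma restrictPair_snd {U U' : Set (E d)} (h : U' ⊆ U) (w : Pair U) :
    (restrictPair h w).snd =ᵐ[volume.restrict U'] w.snd :=
  ((snd_memLp w).mono_measure (Measure.restrict_mono_set volume h)).coeFn_toLp

/-- A test function supported in `U'` is also one for `U`, and it contributes nothing on `U \ U'`.
-/
lemma restrictPair_mem_H1 {U U' : Set (E d)} (h : U' ⊆ U) (hU : MeasurableSet U) {w : Pair U}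
    (hw : w ∈ H1 U) : restrictPair h w ∈ H1 U' := by
  intro η hη hc hs i
  have hibp := hw η hη hc (hs.trans h) i
  rw [setIntegral_eq_of_subset_of_forall_sdiff_eq_zero hU h,
    setIntegral_eq_of_subset_of_forall_sdiff_eq_zero hU h] at hibp
  · convert hibp using 1
    · refine integral_congr_ae ?_
      filter_upwards [restrictPair_fst h w] with x hx
      rw [hx]
    · congr 1
      refine integral_congr_ae ?_
      filter_upwards [restrictPair_snd h w] with x hx
      rw [hx]
  · intro x hx
    rw [image_eq_zero_of_notMem_tsupport fun hxs => hx.2 (hs hxs)]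
    simp
  · intro x hx
    rw [fderiv_of_notMem_tsupport ℝ fun hxs => hx.2 (hs hxs)]
    simp

lemma ofReal_norm_sq_eq_lintegral {F : Type*} [NormedAddCommGroup F] {α : Type*}
    [MeasurableSpace α] {μ : Measure α} (f : Lp F 2 μ) :
    ENNReal.ofReal (‖f‖ ^ 2) = ∫⁻ x, ‖f x‖ₑ ^ 2 ∂μ := by
  rw [ENNReal.ofReal_pow (norm_nonneg _), ofReal_norm, Lp.enorm_def,
    eLpNorm_eq_lintegral_rpow_enorm_toReal (by norm_num) (by norm_num), ← ENNReal.rpow_natCast,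
    ← ENNReal.rpow_mul]
  norm_num

lemma Pair.norm_sq {U : Set (E d)} (w : Pair U) : ‖w‖ ^ 2 = ‖w.fst‖ ^ 2 + ‖w.snd‖ ^ 2 :=
  WithLp.prod_norm_sq_eq_of_L2 w

/-- The Poincaré inequality with the mean value on the right-hand side. -/
theorem H1.lintegral_sq_le {P : Set (E d)} (hPo : IsOpen P) (hP : Convex ℝ P)
    (hfin : volume P ≠ ∞) {h : ℝ} (hh : ∀ x ∈ P, ∀ y ∈ P, ‖x - y‖ ≤ h) {w : Pair P}
    (hw : w ∈ H1 P) :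
    ∫⁻ x in P, ‖w.fst x‖ₑ ^ 2 ≤
      8 * (ENNReal.ofReal h ^ 2 * 2 ^ d) * (∫⁻ x in P, ‖w.snd x‖ₑ ^ 2) +
        2 * (volume P)⁻¹ * ‖∫ x in P, w.fst x‖ₑ ^ 2 := by
  rcases eq_or_ne (volume P) 0 with h0 | h0
  · rw [setLIntegral_measure_zero _ _ h0]
    exact zero_le
  have : IsFiniteMeasure (volume.restrict P) := ⟨by simpa using hfin.lt_top⟩
  have hint : Integrable w.fst (volume.restrict P) := (fst_memLp w).integrable (by norm_num)
  have hum : StronglyMeasurable w.fst := Lp.stronglyMeasurable _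
  set c := volume P with hc
  set m := ∫ x in P, w.fst x with hm
  -- Obtained from `|P| w(x) = ∫ (w(x) - w(y)) dy + ∫ w`. Multiplying by `c ^ 2` throughout avoids
  -- divisions in `ℝ≥0∞` until the end.
  have hpt : ∀ x, c ^ 2 * ‖w.fst x‖ₑ ^ 2 ≤
      2 * (c * ∫⁻ y in P, ‖w.fst x - w.fst y‖ₑ ^ 2) + 2 * ‖m‖ₑ ^ 2 := by
    intro x
    have h1 : c * ‖w.fst x‖ₑ ≤ (∫⁻ y in P, ‖w.fst x - w.fst y‖ₑ) + ‖m‖ₑ := by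
      have h2 : ∫ y in P, (w.fst x - w.fst y) = c.toReal • w.fst x - m := by
        rw [integral_sub (integrable_const _) hint, setIntegral_const]
        rfl
      have h3 : c.toReal • w.fst x = (∫ y in P, (w.fst x - w.fst y)) + m := by rw [h2]; ring
      have h4 : c * ‖w.fst x‖ₑ = ‖c.toReal • w.fst x‖ₑ := by
        rw [enorm_smul, Real.enorm_of_nonneg ENNReal.toReal_nonneg, ENNReal.ofReal_toReal hfin]
      rw [h4, h3]
      refine (enorm_add_le _ _).trans ?_
      gcongr
      exact enorm_integral_le_lintegral_enorm _
    rw [← mul_pow]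
    refine (pow_le_pow_left' h1 2).trans ((add_sq_le_two_mul _ _).trans ?_)
    gcongr
    refine (CEM.lintegral_sq_le
      (stronglyMeasurable_const.sub hum).enorm.aemeasurable).trans (le_of_eq ?_)
    rw [Measure.restrict_apply_univ]
    rfl
  have hqm : Measurable fun x => ∫⁻ y in P, ‖w.fst x - w.fst y‖ₑ ^ 2 := by
    refine Measurable.lintegral_prod_right'
      (f := fun p : E d × E d => ‖w.fst p.1 - w.fst p.2‖ₑ ^ 2) ?_
    exact (((hum.comp_measurable measurable_fst).sub
      (hum.comp_measurable measurable_snd)).enorm).pow_const 2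
  have hkey : c ^ 2 * ∫⁻ x in P, ‖w.fst x‖ₑ ^ 2 ≤
      c ^ 2 * (8 * (ENNReal.ofReal h ^ 2 * 2 ^ d) * (∫⁻ x in P, ‖w.snd x‖ₑ ^ 2) +
        2 * c⁻¹ * ‖m‖ₑ ^ 2) := by
    calc c ^ 2 * ∫⁻ x in P, ‖w.fst x‖ₑ ^ 2
        = ∫⁻ x in P, c ^ 2 * ‖w.fst x‖ₑ ^ 2 :=
          (lintegral_const_mul _ (hum.enorm.pow_const 2)).symm
      _ ≤ ∫⁻ x in P, (2 * (c * ∫⁻ y in P, ‖w.fst x - w.fst y‖ₑ ^ 2) + 2 * ‖m‖ₑ ^ 2) :=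
          lintegral_mono hpt
      _ = 2 * (c * ∫⁻ x in P, ∫⁻ y in P, ‖w.fst x - w.fst y‖ₑ ^ 2) + 2 * ‖m‖ₑ ^ 2 * c := by
          rw [lintegral_add_left ((hqm.const_mul c).const_mul 2),
            lintegral_const_mul _ (hqm.const_mul c), lintegral_const_mul _ hqm, setLIntegral_const]
      _ ≤ 2 * (c * (4 * (ENNReal.ofReal h ^ 2 * 2 ^ d) * c * ∫⁻ x in P, ‖w.snd x‖ₑ ^ 2)) +
          2 * ‖m‖ₑ ^ 2 * c := by
          gcongr
          exact H1.lintegral_sub_sq_le hPo hP hfin hh hw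
      _ = c ^ 2 * (8 * (ENNReal.ofReal h ^ 2 * 2 ^ d) * (∫⁻ x in P, ‖w.snd x‖ₑ ^ 2)) +
          (c * c⁻¹) * (2 * ‖m‖ₑ ^ 2 * c) := by
          rw [ENNReal.mul_inv_cancel h0 hfin]; ring
      _ = _ := by ring
  exact (ENNReal.mul_le_mul_iff_right (pow_ne_zero 2 h0) (ENNReal.pow_ne_top hfin)).1 hkey

/-- The half-open cubes of side length `h`. -/
def gridCube (d : ℕ) (h : ℝ) (z : Fin d → ℤ) : Set (E d) :=
  {x | ∀ i, (z i : ℝ) * h ≤ x i ∧ x i < ((z i : ℝ) + 1) * h}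

lemma convex_gridCube (h : ℝ) (z : Fin d → ℤ) : Convex ℝ (gridCube d h z) := by
  intro x hx y hy a b ha hb hab i
  have h1 := convex_Ico ((z i : ℝ) * h) (((z i : ℝ) + 1) * h) (hx i) (hy i) ha hb hab
  simpa using h1

lemma measurableSet_gridCube (h : ℝ) (z : Fin d → ℤ) : MeasurableSet (gridCube d h z) := by
  have : gridCube d h z = ⋂ i, {x : E d | (z i : ℝ) * h ≤ x i} ∩
      {x | x i < ((z i : ℝ) + 1) * h} := by
    ext x; simp [gridCube]
  rw [this]
  refine MeasurableSet.iInter fun i => MeasurableSet.inter ?_ ?_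
  · exact measurableSet_le measurable_const (by fun_prop)
  · exact measurableSet_lt (by fun_prop) measurable_const

lemma mem_gridCube_iff {h : ℝ} (hh : 0 < h) (z : Fin d → ℤ) (x : E d) :
    x ∈ gridCube d h z ↔ ∀ i, ⌊x i / h⌋ = z i := by
  refine forall_congr' fun i => ?_
  rw [Int.floor_eq_iff, le_div_iff₀ hh, div_lt_iff₀ hh]

lemma norm_sub_le_of_mem_gridCube {h : ℝ} (hh : 0 < h) {z : Fin d → ℤ} {x y : E d}
    (hx : x ∈ gridCube d h z) (hy : y ∈ gridCube d h z) : ‖x - y‖ ≤ Real.sqrt d * h := by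
  rw [EuclideanSpace.norm_eq]
  refine Real.sqrt_le_iff.2 ⟨by positivity, ?_⟩
  rw [mul_pow, Real.sq_sqrt (by positivity)]
  calc ∑ i, ‖(x - y) i‖ ^ 2 ≤ ∑ _i : Fin d, h ^ 2 := by
        refine Finset.sum_le_sum fun i _ => ?_
        refine pow_le_pow_left₀ (norm_nonneg _) ?_ 2
        rw [PiLp.sub_apply, Real.norm_eq_abs, abs_le]
        constructor <;> linarith [hx i, hy i]
    _ = _ := by simp

/-- Rellich's theorem on bounded open convex sets, in the form of an inequality: up to a small
multiple of the Sobolev norm, the `L²` norm is controlled by finitely many functionals. -/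
theorem H1.exists_functionals {D : Set (E d)} (hDo : IsOpen D) (hD : Convex ℝ D)
    (hDb : Bornology.IsBounded D) {ε : ℝ} (hε : 0 < ε) :
    ∃ (ι : Type) (_ : Fintype ι) (ℓ : ι → Pair D →L[ℂ] ℂ), ∀ w ∈ H1 D,
      ‖w.fst‖ ^ 2 ≤ ε * ‖w‖ ^ 2 + ∑ k, ‖ℓ k w‖ ^ 2 := by
  obtain ⟨R, hR⟩ := hDb.subset_closedBall 0
  -- The cube side is chosen so that the Poincaré constant of a piece, whose diameter is at most `√d
  -- * h`, is at most `ε`.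
  obtain ⟨h, hh, hhε⟩ : ∃ h : ℝ, 0 < h ∧ 8 * ((Real.sqrt d * h) ^ 2 * 2 ^ d) ≤ ε := by
    have hc : Tendsto (fun h : ℝ => 8 * ((Real.sqrt d * h) ^ 2 * 2 ^ d)) (𝓝[>] 0) (𝓝 0) := by
      have : Continuous fun h : ℝ => 8 * ((Real.sqrt d * h) ^ 2 * 2 ^ d) := by fun_prop
      have h0 := this.tendsto 0
      simp only [mul_zero, ne_eq, OfNat.ofNat_ne_zero, not_false_eq_true, zero_pow, zero_mul] at h0
      exact h0.mono_left nhdsWithin_le_nhds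
    have hev := (hc.eventually (gt_mem_nhds hε)).and self_mem_nhdsWithin
    obtain ⟨h, h1, h2⟩ := hev.exists
    exact ⟨h, h2, h1.le⟩
  have hDfin : volume D ≠ ∞ := hDb.measure_lt_top.ne
  set C : (Fin d → ℤ) → Set (E d) := fun z => D ∩ gridCube d h z with hC
  -- The pieces `C z` partition `D` but need not be open. Being convex they have null frontier, so
  -- their interiors carry the same integrals, and Poincaré holds there.
  set P : (Fin d → ℤ) → Set (E d) := fun z => interior (C z) with hP
  have hCm : ∀ z, MeasurableSet (C z) := fun z =>
    hDo.measurableSet.inter (measurableSet_gridCube h z)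
  have hCc : ∀ z, Convex ℝ (C z) := fun z => hD.inter (convex_gridCube h z)
  have hPD : ∀ z, P z ⊆ D := fun z => interior_subset.trans Set.inter_subset_left
  have hPae : ∀ z, P z =ᵐ[volume] C z := fun z =>
    interior_ae_eq_of_null_frontier ((hCc z).addHaar_frontier volume)
  have hPfin : ∀ z, volume (P z) ≠ ∞ := fun z => (measure_mono (hPD z)).trans_lt hDfin.lt_top |>.ne
  set Z : Finset (Fin d → ℤ) := Finset.Icc (fun _ => ⌊-R / h⌋) (fun _ => ⌊R / h⌋) with hZ
  have hcover : D = ⋃ z ∈ Z, C z := by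
    ext x
    simp only [Set.mem_iUnion, hC, Set.mem_inter_iff, exists_prop]
    refine ⟨fun hx => ⟨fun i => ⌊x i / h⌋, ?_, hx, (mem_gridCube_iff hh _ x).2 fun _ => rfl⟩,
      fun ⟨_, _, hx, _⟩ => hx⟩
    have hxi : ∀ i, |x i| ≤ R := fun i =>
      (PiLp.norm_apply_le x i).trans (mem_closedBall_zero_iff.1 (hR hx))
    rw [hZ, Finset.mem_Icc]
    refine ⟨fun i => Int.floor_le_floor ?_, fun i => Int.floor_le_floor ?_⟩
    · exact div_le_div_of_nonneg_right (abs_le.1 (hxi i)).1 hh.le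
    · exact div_le_div_of_nonneg_right (abs_le.1 (hxi i)).2 hh.le
  have hdisj : Set.PairwiseDisjoint (↑Z : Set (Fin d → ℤ)) C := by
    intro z _ z' _ hzz'
    refine Set.disjoint_left.2 fun x hx hx' => hzz' ?_
    funext i
    rw [← (mem_gridCube_iff hh z x).1 hx.2 i, (mem_gridCube_iff hh z' x).1 hx'.2 i]
  have hsplit : ∀ g : E d → ℝ≥0∞, ∫⁻ x in D, g x = ∑ z ∈ Z, ∫⁻ x in P z, g x := by
    intro g
    conv_lhs => rw [hcover]
    rw [lintegral_biUnion_finset hdisj fun z _ => hCm z]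
    exact Finset.sum_congr rfl fun z _ => setLIntegral_congr (hPae z).symm
  have hDP : ∀ z, (volume.restrict D).restrict (P z) = volume.restrict (P z) := fun z => by
    rw [Measure.restrict_restrict isOpen_interior.measurableSet,
      Set.inter_eq_left.2 (hPD z)]
  have hPfin' : ∀ z, volume.restrict D (P z) ≠ ∞ := fun z =>
    ((Measure.restrict_apply_le D (P z)).trans_lt (hPfin z).lt_top).ne
  -- The integral over a piece, scaled so that its squared modulus is the mean value term `2 |P|⁻¹
  -- |∫ w|²` of the Poincaré inequality.
  let ℓ : (Fin d → ℤ) → Pair D →L[ℂ] ℂ := fun z =>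
    (Real.sqrt (2 * (volume (P z)).toReal⁻¹) : ℂ) •
      (innerSL ℂ (indicatorConstLp 2 (isOpen_interior.measurableSet : MeasurableSet (P z))
        (hPfin' z) (1 : ℂ))).comp (WithLp.fstL 2 ℂ _ _)
  have hℓ : ∀ z w, ENNReal.ofReal (‖ℓ z w‖ ^ 2) =
      ENNReal.ofReal (2 * (volume (P z)).toReal⁻¹) * ‖∫ x in P z, w.fst x‖ₑ ^ 2 := by
    intro z w
    have h1 : ℓ z w = (Real.sqrt (2 * (volume (P z)).toReal⁻¹) : ℂ) * ∫ x in P z, w.fst x := by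
      have := L2.inner_indicatorConstLp_one (𝕜 := ℂ)
        (isOpen_interior.measurableSet : MeasurableSet (P z)) (hPfin' z) w.fst
      rw [hDP] at this
      rw [← this]
      rfl
    rw [h1, norm_mul, mul_pow, Complex.norm_real, Real.norm_eq_abs, sq_abs,
      Real.sq_sqrt (by positivity), ENNReal.ofReal_mul (by positivity),
      ENNReal.ofReal_pow (norm_nonneg _), ofReal_norm]
  refine ⟨Z, inferInstance, fun z => ℓ z, fun w hw => ?_⟩
  have hpiece : ∀ z ∈ Z, ∫⁻ x in P z, ‖w.fst x‖ₑ ^ 2 ≤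
      ENNReal.ofReal ε * (∫⁻ x in P z, ‖w.snd x‖ₑ ^ 2) + ENNReal.ofReal (‖ℓ z w‖ ^ 2) := by
    intro z _
    have h1 := H1.lintegral_sq_le isOpen_interior (hCc z).interior (hPfin z)
      (h := Real.sqrt d * h)
      (fun x hx y hy => norm_sub_le_of_mem_gridCube hh (interior_subset hx).2
        (interior_subset hy).2) (restrictPair_mem_H1 (hPD z) hDo.measurableSet hw)
    have e1 : ∫⁻ x in P z, ‖(restrictPair (hPD z) w).fst x‖ₑ ^ 2 = ∫⁻ x in P z, ‖w.fst x‖ₑ ^ 2 :=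
      lintegral_congr_ae (by filter_upwards [restrictPair_fst (hPD z) w] with x hx; rw [hx])
    have e2 : ∫⁻ x in P z, ‖(restrictPair (hPD z) w).snd x‖ₑ ^ 2 = ∫⁻ x in P z, ‖w.snd x‖ₑ ^ 2 :=
      lintegral_congr_ae (by filter_upwards [restrictPair_snd (hPD z) w] with x hx; rw [hx])
    have e3 : ∫ x in P z, (restrictPair (hPD z) w).fst x = ∫ x in P z, w.fst x :=
      integral_congr_ae (restrictPair_fst (hPD z) w)
    rw [e1, e2, e3] at h1
    rcases eq_or_ne (volume (P z)) 0 with h0 | h0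
    · rw [setLIntegral_measure_zero _ _ h0]
      exact zero_le
    refine h1.trans (add_le_add ?_ (le_of_eq ?_))
    · gcongr
      rw [← ENNReal.ofReal_pow (by positivity)]
      have h8 : (8 : ℝ≥0∞) = ENNReal.ofReal 8 := by simp
      have h2d : (2 : ℝ≥0∞) ^ d = ENNReal.ofReal (2 ^ d) := by
        rw [ENNReal.ofReal_pow (by norm_num)]; simp
      rw [h8, h2d, ← ENNReal.ofReal_mul (by positivity), ← ENNReal.ofReal_mul (by positivity)]
      exact ENNReal.ofReal_le_ofReal hhε
    · rw [hℓ, ENNReal.ofReal_mul (by norm_num), ENNReal.ofReal_inv_of_pos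
        (ENNReal.toReal_pos h0 (hPfin z)), ENNReal.ofReal_toReal (hPfin z), ENNReal.ofReal_ofNat]
  have hsum : ENNReal.ofReal (‖w.fst‖ ^ 2) ≤
      ENNReal.ofReal (ε * ‖w.snd‖ ^ 2 + ∑ z ∈ Z, ‖ℓ z w‖ ^ 2) := by
    rw [ENNReal.ofReal_add (by positivity) (Finset.sum_nonneg fun _ _ => by positivity),
      ENNReal.ofReal_mul hε.le, ENNReal.ofReal_sum_of_nonneg fun _ _ => by positivity,
      ofReal_norm_sq_eq_lintegral, ofReal_norm_sq_eq_lintegral, hsplit, hsplit, Finset.mul_sum,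
      ← Finset.sum_add_distrib]
    exact Finset.sum_le_sum hpiece
  have hnn : 0 ≤ ∑ z ∈ Z, ‖ℓ z w‖ ^ 2 := Finset.sum_nonneg fun _ _ => by positivity
  rw [ENNReal.ofReal_le_ofReal_iff (by positivity)] at hsum
  rw [Finset.sum_coe_sort Z fun z => ‖ℓ z w‖ ^ 2, Pair.norm_sq]
  nlinarith [sq_nonneg ‖w.fst‖]

/-! ### Weighted `L²` products and the energy form -/

/-- `μ` is a measurable weight on `U` with `c ≤ μ ≤ C`. -/
structure IsBddWeight (μ : E d → ℝ) (U : Set (E d)) (c C : ℝ) : Prop where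
  aemeasurable : AEMeasurable μ (volume.restrict U)
  lower : ∀ᵐ x ∂volume.restrict U, c ≤ μ x
  upper : ∀ᵐ x ∂volume.restrict U, μ x ≤ C

lemma L2.norm_sq_eq_integral {F : Type*} [NormedAddCommGroup F] [InnerProductSpace ℂ F] {α : Type*}
    [MeasurableSpace α] {ν : Measure α} (f : Lp F 2 ν) : ‖f‖ ^ 2 = ∫ x, ‖f x‖ ^ 2 ∂ν := by
  have h : inner ℂ f f = ((∫ x, ‖f x‖ ^ 2 ∂ν : ℝ) : ℂ) := by
    rw [MeasureTheory.L2.inner_def, ← integral_complex_ofReal]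
    refine integral_congr_ae (Eventually.of_forall fun x => ?_)
    simp only [inner_self_eq_norm_sq_to_K]
    push_cast
    rfl
  rw [inner_self_eq_norm_sq_to_K] at h
  exact Complex.ofReal_injective (by rw [← h]; push_cast; rfl)

lemma integrable_norm_sq {F : Type*} [NormedAddCommGroup F] {α : Type*}
    [MeasurableSpace α] {ν : Measure α} (f : Lp F 2 ν) : Integrable (fun x => ‖f x‖ ^ 2) ν :=
  (Lp.memLp f).integrable_norm_pow (by norm_num)

lemma sForm_congr {μ : E d → ℝ} {U : Set (E d)} {u u' v v' : E d → ℂ}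
    (hu : u =ᵐ[volume.restrict U] u') (hv : v =ᵐ[volume.restrict U] v') :
    sForm μ U u v = sForm μ U u' v' := by
  refine integral_congr_ae ?_
  filter_upwards [hu, hv] with x h1 h2
  rw [h1, h2]

lemma sForm_self (μ : E d → ℝ) (U : Set (E d)) (u : E d → ℂ) :
    sForm μ U u u = ((∫ x in U, μ x * ‖u x‖ ^ 2 : ℝ) : ℂ) := by
  rw [sForm, ← integral_complex_ofReal]
  refine integral_congr_ae (Eventually.of_forall fun x => ?_)
  simp only
  rw [mul_assoc, Complex.mul_conj, Complex.normSq_eq_norm_sq]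
  push_cast
  rfl

namespace IsBddWeight

variable {μ : E d → ℝ} {U : Set (E d)} {c C : ℝ}

lemma abs_le (h : IsBddWeight μ U c C) (hc : 0 ≤ c) :
    ∀ᵐ x ∂volume.restrict U, |μ x| ≤ C := by
  filter_upwards [h.lower, h.upper] with x h1 h2
  rwa [abs_of_nonneg (hc.trans h1)]

lemma integrable_mul (h : IsBddWeight μ U c C) (hc : 0 ≤ c) {g : E d → ℝ}
    (hg : Integrable g (volume.restrict U)) :
    Integrable (fun x => μ x * g x) (volume.restrict U) :=
  hg.bdd_mul (c := C) h.aemeasurable.aestronglyMeasurable (h.abs_le hc)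

lemma integrable (h : IsBddWeight μ U c C) (hc : 0 ≤ c) (u v : L2 U) :
    Integrable (fun x => (μ x : ℂ) * u x * conj (v x)) (volume.restrict U) := by
  have h1 : Integrable (fun x => inner ℂ (v x) (u x)) (volume.restrict U) :=
    MeasureTheory.L2.integrable_inner v u
  refine (h1.bdd_mul (f := fun x => (μ x : ℂ)) (c := C)
    (Complex.measurable_ofReal.comp_aemeasurable h.aemeasurable).aestronglyMeasurable ?_).congr
    (Eventually.of_forall fun x => ?_)
  · filter_upwards [h.abs_le hc] with x hx
    simpa using hx
  · simp only [RCLike.inner_apply]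
    ring

lemma isHermForm (h : IsBddWeight μ U c C) (hc : 0 ≤ c) :
    IsHermForm fun u v : L2 U => sForm μ U u v where
  add_left u v w := by
    simp only [sForm]
    rw [← integral_add (h.integrable hc _ _) (h.integrable hc _ _)]
    refine integral_congr_ae ?_
    filter_upwards [Lp.coeFn_add u v] with x hx
    rw [hx, Pi.add_apply]
    ring
  smul_left r u v := by
    simp only [sForm]
    rw [← integral_const_mul]
    refine integral_congr_ae ?_
    filter_upwards [Lp.coeFn_smul r u] with x hx
    rw [hx, Pi.smul_apply, smul_eq_mul]
    ring
  conj_symm u v := by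
    simp only [sForm]
    rw [← integral_conj]
    refine integral_congr_ae (Eventually.of_forall fun x => ?_)
    simp only [map_mul, Complex.conj_ofReal, Complex.conj_conj]
    ring
  nonneg u := by
    rw [sForm_self, Complex.ofReal_re]
    refine integral_nonneg_of_ae ?_
    filter_upwards [h.lower] with x hx
    exact mul_nonneg (hc.trans hx) (sq_nonneg _)

lemma sForm_self_le (h : IsBddWeight μ U c C) (hc : 0 ≤ c) (u : L2 U) :
    (sForm μ U u u).re ≤ C * ‖u‖ ^ 2 := by
  rw [sForm_self, Complex.ofReal_re, L2.norm_sq_eq_integral, ← integral_const_mul]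
  refine integral_mono_ae (h.integrable_mul hc (integrable_norm_sq u))
    ((integrable_norm_sq u).const_mul C) ?_
  filter_upwards [h.upper] with x hx
  exact mul_le_mul_of_nonneg_right hx (sq_nonneg _)

lemma le_sForm_self (h : IsBddWeight μ U c C) (hc : 0 ≤ c) (u : L2 U) :
    c * ‖u‖ ^ 2 ≤ (sForm μ U u u).re := by
  rw [sForm_self, Complex.ofReal_re, L2.norm_sq_eq_integral, ← integral_const_mul]
  refine integral_mono_ae ((integrable_norm_sq u).const_mul c)
    (h.integrable_mul hc (integrable_norm_sq u)) ?_
  filter_upwards [h.lower] with x hx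
  exact mul_le_mul_of_nonneg_right hx (sq_nonneg _)

lemma inv (h : IsBddWeight μ U c C) (hc : 0 < c) : IsBddWeight (fun x => (μ x)⁻¹) U 0 c⁻¹ where
  aemeasurable := h.aemeasurable.inv
  lower := by
    filter_upwards [h.lower] with x hx
    exact inv_nonneg.2 (hc.le.trans hx)
  upper := by
    filter_upwards [h.lower] with x hx
    exact inv_anti₀ hc hx

lemma sInvNorm_le (h : IsBddWeight μ U c C) (hc : 0 < c) (f : L2 U) :
    sInvNorm μ U f ≤ Real.sqrt c⁻¹ * ‖f‖ := by
  rw [sInvNorm]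
  refine Real.sqrt_le_iff.2 ⟨by positivity, ?_⟩
  rw [mul_pow, Real.sq_sqrt (by positivity)]
  have h1 := (h.inv hc).sForm_self_le le_rfl f
  rwa [sForm_self, Complex.ofReal_re] at h1

/-- The duality between the norms `‖·‖_s` and `‖·‖_{s⁻¹}`. -/
lemma norm_l2Form_le (h : IsBddWeight μ U c C) (hc : 0 < c) (f : L2 U) (v : Pair U) :
    ‖l2Form f v‖ ≤ sInvNorm μ U f * sNorm μ U v.fst := by
  -- For `g = μ⁻¹ f` one has `(f, v) = s(g, v)` and `‖g‖_s = ‖f‖_{s⁻¹}`, so the duality is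
  -- Cauchy-Schwarz for `s`.
  have hmem : MemLp (fun x => ((μ x)⁻¹ : ℂ) * f x) 2 (volume.restrict U) := by
    refine MemLp.of_le_mul (c := c⁻¹) (Lp.memLp f) ?_ ?_
    · refine AEStronglyMeasurable.mul ?_ (Lp.memLp f).1
      exact (Complex.measurable_ofReal.comp_aemeasurable
        h.aemeasurable).inv.aestronglyMeasurable
    · filter_upwards [h.lower] with x hx
      rw [norm_mul, norm_inv, Complex.norm_real, Real.norm_of_nonneg (hc.le.trans hx)]
      gcongr
  set g : L2 U := hmem.toLp with hg
  have hgae : g =ᵐ[volume.restrict U] fun x => ((μ x)⁻¹ : ℂ) * f x := hmem.coeFn_toLp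
  have h1 : l2Form f v = sForm μ U g v.fst := by
    refine integral_congr_ae ?_
    filter_upwards [h.lower, hgae] with x hx hgx
    have : (μ x : ℂ) ≠ 0 := by exact_mod_cast (hc.trans_le hx).ne'
    rw [hgx]
    field_simp
  have h2 : (sForm μ U g g).re = ∫ x in U, (μ x)⁻¹ * ‖f x‖ ^ 2 := by
    rw [sForm_self, Complex.ofReal_re]
    refine integral_congr_ae ?_
    filter_upwards [h.lower, hgae] with x hx hgx
    have : μ x ≠ 0 := (hc.trans_le hx).ne'
    rw [hgx, norm_mul, norm_inv, Complex.norm_real, Real.norm_of_nonneg (hc.le.trans hx)]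
    field_simp
  rw [h1, sInvNorm, sNorm, ← h2, ← Real.sqrt_mul ((h.isHermForm hc.le).nonneg g)]
  exact Real.le_sqrt_of_sq_le ((h.isHermForm hc.le).norm_sq_le g v.fst)

lemma mono_set (h : IsBddWeight μ U c C) {U' : Set (E d)} (hU : U' ⊆ U) :
    IsBddWeight μ U' c C where
  aemeasurable := h.aemeasurable.mono_measure (Measure.restrict_mono_set _ hU)
  lower := ae_restrict_of_ae_restrict_of_subset hU h.lower
  upper := ae_restrict_of_ae_restrict_of_subset hU h.upper

end IsBddWeight

lemma IsHermForm.comap {X Y : Type*} [AddCommGroup X] [Module ℂ X] [AddCommGroup Y] [Module ℂ Y]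
    {B : Y → Y → ℂ} (hB : IsHermForm B) (L : X →ₗ[ℂ] Y) :
    IsHermForm fun x y => B (L x) (L y) where
  add_left x y z := by rw [map_add, hB.add_left]
  smul_left c x y := by rw [map_smul, hB.smul_left]
  conj_symm x y := hB.conj_symm _ _
  nonneg x := hB.nonneg _

lemma IsHermForm.add {X : Type*} [AddCommGroup X] [Module ℂ X] {A B : X → X → ℂ}
    (hA : IsHermForm A) (hB : IsHermForm B) : IsHermForm fun x y => A x y + B x y where
  add_left x y z := by rw [hA.add_left, hB.add_left]; ring
  smul_left c x y := by rw [hA.smul_left, hB.smul_left]; ring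
  conj_symm x y := by rw [map_add, hA.conj_symm, hB.conj_symm]
  nonneg x := by rw [Complex.add_re]; exact add_nonneg (hA.nonneg x) (hB.nonneg x)

lemma isHermForm_inner {X : Type*} [NormedAddCommGroup X] [InnerProductSpace ℂ X] {t : ℝ}
    (ht : 0 ≤ t) : IsHermForm fun x y : X => (t : ℂ) * inner ℂ y x where
  add_left x y z := by rw [inner_add_right]; ring
  smul_left c x y := by rw [inner_smul_right]; ring
  conj_symm x y := by simp
  nonneg x := by
    rw [Complex.re_ofReal_mul]
    exact mul_nonneg ht (inner_self_nonneg (𝕜 := ℂ))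

/-- The projection of a pair onto its scalar component. -/
def Pair.fstₗ (U : Set (E d)) : Pair U →ₗ[ℂ] L2 U where
  toFun w := w.fst
  map_add' _ _ := rfl
  map_smul' _ _ := rfl

/-- The projection of a pair onto its vector component. -/
def Pair.sndₗ (U : Set (E d)) :
    Pair U →ₗ[ℂ] Lp (EuclideanSpace ℂ (Fin d)) 2 (volume.restrict U) where
  toFun w := w.snd
  map_add' _ _ := rfl
  map_smul' _ _ := rfl

section Energy

variable {V : E d → ℝ} {U : Set (E d)} {c C : ℝ}

lemma aForm_eq (hV : IsBddWeight V U c C) (hc : 0 ≤ c) (ε : ℝ) (u v : Pair U) :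
    aForm ε V u v = ((ε ^ 2 / 2 : ℝ) : ℂ) * inner ℂ v.snd u.snd + sForm V U u.fst v.fst := by
  rw [aForm, integral_add ((MeasureTheory.L2.integrable_inner v.snd u.snd).const_mul _)
    (hV.integrable hc u.fst v.fst), integral_const_mul]
  rfl

lemma isHermForm_aForm (hV : IsBddWeight V U c C) (hc : 0 ≤ c) (ε : ℝ) :
    IsHermForm (aForm ε V (U := U)) := by
  have h : aForm ε V (U := U) = fun u v =>
      ((ε ^ 2 / 2 : ℝ) : ℂ) * inner ℂ (Pair.sndₗ U v) (Pair.sndₗ U u) +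
        sForm V U (Pair.fstₗ U u) (Pair.fstₗ U v) :=
    funext fun u => funext fun v => aForm_eq hV hc ε u v
  rw [h]
  exact ((isHermForm_inner (by positivity)).comap (Pair.sndₗ U)).add
    ((hV.isHermForm hc).comap (Pair.fstₗ U))

lemma aForm_self_re (hV : IsBddWeight V U c C) (hc : 0 ≤ c) (ε : ℝ) (u : Pair U) :
    (aForm ε V u u).re = ε ^ 2 / 2 * ‖u.snd‖ ^ 2 + (sForm V U u.fst u.fst).re := by
  rw [aForm_eq hV hc, Complex.add_re, Complex.re_ofReal_mul]
  congr 2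
  exact inner_self_eq_norm_sq (𝕜 := ℂ) u.snd

lemma le_aForm_self (hV : IsBddWeight V U c C) (hc : 0 ≤ c) (ε : ℝ) (u : Pair U) :
    min (ε ^ 2 / 2) c * ‖u‖ ^ 2 ≤ (aForm ε V u u).re := by
  rw [aForm_self_re hV hc, Pair.norm_sq]
  have h1 := hV.le_sForm_self hc u.fst
  have h2 := min_le_left (ε ^ 2 / 2) c
  have h3 := min_le_right (ε ^ 2 / 2) c
  nlinarith [mul_le_mul_of_nonneg_right h2 (sq_nonneg ‖u.snd‖),
    mul_le_mul_of_nonneg_right h3 (sq_nonneg ‖u.fst‖)]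

lemma aForm_self_le (hV : IsBddWeight V U c C) (hc : 0 ≤ c) (ε : ℝ) (u : Pair U) :
    (aForm ε V u u).re ≤ max (ε ^ 2 / 2) C * ‖u‖ ^ 2 := by
  rw [aForm_self_re hV hc, Pair.norm_sq]
  have h1 := hV.sForm_self_le hc u.fst
  have h2 := le_max_left (ε ^ 2 / 2) C
  have h3 := le_max_right (ε ^ 2 / 2) C
  nlinarith [mul_le_mul_of_nonneg_right h2 (sq_nonneg ‖u.snd‖),
    mul_le_mul_of_nonneg_right h3 (sq_nonneg ‖u.fst‖)]

end Energy

/-! ### The Sobolev spaces are closed -/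

lemma memLp_of_continuous {F : Type*} [NormedAddCommGroup F] {U : Set (E d)}
    (hU : MeasurableSet U) (hb : Bornology.IsBounded U)
    {p : E d → F} (hp : Continuous p) : MemLp p 2 (volume.restrict U) := by
  obtain ⟨C, hC⟩ := hb.isCompact_closure.exists_bound_of_continuousOn hp.continuousOn
  have : IsFiniteMeasure (volume.restrict U) := ⟨by simpa using hb.measure_lt_top⟩
  refine MemLp.of_bound hp.aestronglyMeasurable C ?_
  filter_upwards [ae_restrict_mem hU] with x hx
  exact hC x (subset_closure hx)

/-- On a bounded set `∂ᵢη` and `η eᵢ` are square integrable even when `η` is not compactly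
supported, so each identity says that a continuous functional vanishes. Closedness of both Sobolev
spaces follows, the periodic one included. -/
lemma exists_intByParts_functional {U : Set (E d)} (hU : MeasurableSet U)
    (hb : Bornology.IsBounded U) {η : E d → ℝ} (hη : ContDiff ℝ (⊤ : ℕ∞) η) :
    ∃ L : Fin d → Pair U →L[ℂ] ℂ, ∀ w, IntByParts U w η ↔ ∀ i, L i w = 0 := by
  have hη1 : ∀ i : Fin d, Continuous fun x =>
      ((fderiv ℝ η x (EuclideanSpace.single i 1) : ℝ) : ℂ) := fun i =>
    Complex.continuous_ofReal.comp
      ((hη.continuous_fderiv (by simp)).clm_apply continuous_const)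
  have hη2 : ∀ i : Fin d, Continuous fun x =>
      (EuclideanSpace.single i (η x : ℂ) : EuclideanSpace ℂ (Fin d)) := fun i => by
    have h : (fun x => (EuclideanSpace.single i (η x : ℂ) : EuclideanSpace ℂ (Fin d))) =
        fun x => (η x : ℂ) • EuclideanSpace.single i (1 : ℂ) := by
      funext x
      ext k
      by_cases hk : k = i <;> simp [hk]
    rw [h]
    exact (Complex.continuous_ofReal.comp hη.continuous).smul continuous_const
  have m1 := fun i => memLp_of_continuous hU hb (hη1 i)
  have m2 := fun i => memLp_of_continuous hU hb (hη2 i)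
  refine ⟨fun i => (innerSL ℂ (m1 i).toLp).comp (WithLp.fstL 2 ℂ _ _) +
    (innerSL ℂ (m2 i).toLp).comp (WithLp.sndL 2 ℂ _ _), fun w => forall_congr' fun i => ?_⟩
  have e1 : inner ℂ (m1 i).toLp w.fst =
      ∫ x in U, ((fderiv ℝ η x (EuclideanSpace.single i 1) : ℝ) : ℂ) * w.fst x := by
    rw [MeasureTheory.L2.inner_def]
    refine integral_congr_ae ?_
    filter_upwards [(m1 i).coeFn_toLp] with x hx
    rw [hx, RCLike.inner_apply, Complex.conj_ofReal, mul_comm]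
  have e2 : inner ℂ (m2 i).toLp w.snd = ∫ x in U, (η x : ℂ) * (w.snd x) i := by
    rw [MeasureTheory.L2.inner_def]
    refine integral_congr_ae ?_
    filter_upwards [(m2 i).coeFn_toLp] with x hx
    rw [hx, EuclideanSpace.inner_single_left, Complex.conj_ofReal]
  change _ ↔ inner ℂ (m1 i).toLp w.fst + inner ℂ (m2 i).toLp w.snd = 0
  rw [e1, e2, eq_neg_iff_add_eq_zero]

lemma exists_closed_submodule_intByParts {U : Set (E d)} (hU : MeasurableSet U)
    (hb : Bornology.IsBounded U) {𝓣 : Set (E d → ℝ)} (h𝓣 : ∀ η ∈ 𝓣, ContDiff ℝ (⊤ : ℕ∞) η) :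
    ∃ W : Submodule ℂ (Pair U), (W : Set (Pair U)) = {w | ∀ η ∈ 𝓣, IntByParts U w η} ∧
      IsClosed (W : Set (Pair U)) := by
  choose L hL using fun η : 𝓣 => exists_intByParts_functional hU hb (h𝓣 η η.2)
  refine ⟨⨅ (η : 𝓣) (i : Fin d), LinearMap.ker (L η i).toLinearMap, ?_, ?_⟩
  · ext w
    simp only [SetLike.mem_coe, Submodule.mem_iInf, LinearMap.mem_ker, Set.mem_ofPred_eq]
    exact ⟨fun h η hη => (hL ⟨η, hη⟩ w).2 (h ⟨η, hη⟩), fun h η => (hL η w).1 (h η η.2)⟩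
  · simp only [Submodule.coe_iInf]
    exact isClosed_iInter fun η => isClosed_iInter fun i => (L η i).isClosed_ker

lemma exists_closed_submodule_H1 {U : Set (E d)} (hU : MeasurableSet U)
    (hb : Bornology.IsBounded U) :
    ∃ W : Submodule ℂ (Pair U), (W : Set (Pair U)) = H1 U ∧ IsClosed (W : Set (Pair U)) := by
  obtain ⟨W, hW, hWc⟩ := exists_closed_submodule_intByParts hU hb
    (𝓣 := {η | ContDiff ℝ (⊤ : ℕ∞) η ∧ HasCompactSupport η ∧ tsupport η ⊆ U}) fun η hη => hη.1
  refine ⟨W, hW.trans ?_, hWc⟩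
  ext w
  exact ⟨fun h η h1 h2 h3 => h η ⟨h1, h2, h3⟩, fun h η hη => h η hη.1 hη.2.1 hη.2.2⟩

lemma exists_closed_submodule_H1P {a b : Fin d → ℝ} (hU : MeasurableSet (box a b))
    (hb : Bornology.IsBounded (box a b)) :
    ∃ W : Submodule ℂ (Pair (box a b)), (W : Set (Pair (box a b))) = H1P a b ∧
      IsClosed (W : Set (Pair (box a b))) := by
  obtain ⟨W, hW, hWc⟩ := exists_closed_submodule_intByParts hU hb
    (𝓣 := {η | ContDiff ℝ (⊤ : ℕ∞) η ∧
      (HasCompactSupport η ∧ tsupport η ⊆ box a b ∨ IsPeriodic a b η)}) fun η hη => hη.1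
  refine ⟨W, hW.trans ?_, hWc⟩
  ext w
  exact ⟨fun h => ⟨fun η h1 h2 h3 => h η ⟨h1, .inl ⟨h2, h3⟩⟩, fun η h1 h2 => h η ⟨h1, .inr h2⟩⟩,
    fun h η hη => hη.2.elim (fun h' => h.1 η hη.1 h'.1 h'.2) fun h' => h.2 η hη.1 h'⟩

/-! ### Lagrange elements -/

namespace CellKind

lemma contDiff_coord (i : Fin d) : ContDiff ℝ 1 fun t : E d => t i :=
  (EuclideanSpace.proj i : E d →L[ℝ] ℝ).contDiff

lemma contDiff_shape (k : CellKind) (v : k.Vertex d) : ContDiff ℝ 1 (k.shape d v) := by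
  cases k with
  | simplex =>
    cases v with
    | none => exact contDiff_const.sub (ContDiff.sum fun i _ => contDiff_coord i)
    | some i => exact contDiff_coord i
  | cube =>
    refine contDiff_prod fun i _ => ?_
    split_ifs
    · exact contDiff_coord i
    · exact contDiff_const.sub (contDiff_coord i)

lemma sum_shape (k : CellKind) (t : E d) : ∑ v, k.shape d v t = 1 := by
  cases k with
  | simplex =>
    have h : ∑ v : Option (Fin d), CellKind.simplex.shape d v t = 1 := by
      rw [Fintype.sum_option]
      simp [shape]
    exact h
  | cube =>
    have h : ∑ v : Fin d → Bool, ∏ i, (if v i = true then t i else 1 - t i) = 1 := by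
      have h1 := Finset.prod_univ_sum (fun _ : Fin d => (Finset.univ : Finset Bool))
        (fun i b => if b = true then t i else 1 - t i)
      rw [Fintype.piFinset_univ] at h1
      rw [← h1]
      simp
    exact h

lemma refCell_subset (k : CellKind) : k.refCell d ⊆ {t | ∀ i, 0 ≤ t i ∧ t i ≤ 1} := by
  cases k with
  | simplex =>
    rintro t ⟨h0, h1⟩ i
    exact ⟨h0 i, (Finset.single_le_sum (fun j _ => h0 j) (Finset.mem_univ i)).trans h1⟩
  | cube => exact subset_rfl

lemma isCompact_refCell (k : CellKind) : IsCompact (k.refCell d) := by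
  refine Metric.isCompact_of_isClosed_isBounded ?_ ?_
  · cases k with
    | simplex =>
      have h : CellKind.simplex.refCell d =
          (⋂ i, {t : E d | 0 ≤ t i}) ∩ {t | ∑ i, t i ≤ 1} := by
        ext t; simp [refCell]
      rw [h]
      refine IsClosed.inter (isClosed_iInter fun i => ?_) ?_
      · exact isClosed_le continuous_const (contDiff_coord i).continuous
      · exact isClosed_le (continuous_finsetSum _ fun i _ => (contDiff_coord i).continuous)
          continuous_const
    | cube =>
      have h : CellKind.cube.refCell d = ⋂ i, {t : E d | 0 ≤ t i} ∩ {t | t i ≤ 1} := by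
        ext t; simp [refCell]
      rw [h]
      refine isClosed_iInter fun i => IsClosed.inter ?_ ?_
      · exact isClosed_le continuous_const (contDiff_coord i).continuous
      · exact isClosed_le (contDiff_coord i).continuous continuous_const
  · refine (Metric.isBounded_closedBall (x := (0 : E d)) (r := Real.sqrt d)).subset
      ((refCell_subset k).trans fun t ht => ?_)
    rw [mem_closedBall_zero_iff, EuclideanSpace.norm_eq]
    refine Real.sqrt_le_sqrt ?_
    calc ∑ i, ‖t i‖ ^ 2 ≤ ∑ _i : Fin d, (1 : ℝ) := Finset.sum_le_sum fun i _ => by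
          rw [Real.norm_of_nonneg (ht i).1]
          exact pow_le_one₀ (ht i).1 (ht i).2
      _ = d := by simp

/-- The reference vertices are nodes of the shape functions. -/
lemma exists_node (k : CellKind) (v : k.Vertex d) :
    ∃ t ∈ k.refCell d, k.shape d v t = 1 ∧ ∀ w, w ≠ v → k.shape d w t = 0 := by
  cases k with
  | simplex =>
    cases v with
    | none =>
      refine ⟨0, ⟨by simp, by simp⟩, by simp [shape], fun w hw => ?_⟩
      cases w with
      | none => exact absurd rfl hw
      | some i => simp [shape]
    | some i =>
      refine ⟨EuclideanSpace.single i 1, ⟨fun j => ?_, by simp⟩, by simp [shape], fun w hw => ?_⟩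
      · by_cases h : j = i <;> simp [h]
      · cases w with
        | none => simp [shape]
        | some j =>
          have hji : j ≠ i := fun h => hw (by rw [h])
          simp [shape, hji]
  | cube =>
    change Fin d → Bool at v
    refine ⟨WithLp.toLp 2 fun i => if v i = true then 1 else 0, fun i => ?_, ?_, fun w hw => ?_⟩
    · by_cases h : v i = true <;> simp [h]
    · refine Finset.prod_eq_one fun i _ => ?_
      by_cases h : v i = true <;> simp [h]
    · change Fin d → Bool at w
      obtain ⟨i, hi⟩ := Function.ne_iff.1 (show w ≠ v from hw)
      refine Finset.prod_eq_zero (Finset.mem_univ i) ?_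
      cases h1 : w i <;> cases h2 : v i <;> simp_all

lemma card_vertex_le (k : CellKind) : Fintype.card (k.Vertex d) ≤ 2 ^ d := by
  cases k with
  | simplex =>
    have h : Fintype.card (Option (Fin d)) ≤ 2 ^ d := by
      rw [Fintype.card_option, Fintype.card_fin]
      exact Nat.lt_two_pow_self
    exact h
  | cube =>
    have h : Fintype.card (Fin d → Bool) ≤ 2 ^ d := by simp
    exact h

end CellKind

lemma contDiff_refMap (k : CellKind) (p : k.Vertex d → E d) : ContDiff ℝ 1 (refMap k p) :=
  ContDiff.sum fun v _ => (k.contDiff_shape v).smul contDiff_const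

namespace LagrangeCell

variable (K : LagrangeCell d)

/-- The inverse of the reference map, on the element. -/
noncomputable def invMap : E d → E d :=
  Function.invFunOn (refMap K.kind K.vertex) (K.kind.refCell d)

lemma invMap_mem {x : E d} (hx : x ∈ K.carrier) : K.invMap x ∈ K.kind.refCell d :=
  Function.invFunOn_mem hx

lemma refMap_invMap {x : E d} (hx : x ∈ K.carrier) : refMap K.kind K.vertex (K.invMap x) = x :=
  Function.invFunOn_eq hx

lemma isCompact_carrier : IsCompact K.carrier :=
  K.kind.isCompact_refCell.image (contDiff_refMap _ _).continuous

/-- A continuous injection of a compact set is a closed map onto its image. -/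
lemma continuousOn_invMap : ContinuousOn K.invMap K.carrier := by
  rw [continuousOn_iff_isClosed]
  intro A hA
  refine ⟨refMap K.kind K.vertex '' (K.kind.refCell d ∩ A),
    ((K.kind.isCompact_refCell.inter_right hA).image
      (contDiff_refMap _ _).continuous).isClosed, ?_⟩
  ext x
  constructor
  · rintro ⟨hxA, hx⟩
    exact ⟨⟨K.invMap x, ⟨K.invMap_mem hx, hxA⟩, K.refMap_invMap hx⟩, hx⟩
  · rintro ⟨⟨t, ⟨htC, htA⟩, rfl⟩, hx⟩
    refine ⟨?_, hx⟩
    have : K.invMap (refMap K.kind K.vertex t) = t :=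
      K.injOn (K.invMap_mem hx) htC (K.refMap_invMap hx)
    rwa [Set.mem_preimage, this]

lemma dom_subset : K.dom ⊆ K.carrier := interior_subset

lemma isOpen_dom : IsOpen K.dom := isOpen_interior

lemma convex_dom : Convex ℝ K.dom := K.convex.interior

lemma isBounded_dom : Bornology.IsBounded K.dom := K.isCompact_carrier.isBounded.subset K.dom_subset

/-- The derivative of a basis function, as a function on the reference element. -/
noncomputable def basisDeriv (v : K.kind.Vertex d) (t : E d) : E d →L[ℝ] ℝ :=
  (fderiv ℝ (K.kind.shape d v) t).comp (fderiv ℝ (refMap K.kind K.vertex) t).inverse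

/-- Inversion is continuous at invertible maps, and the Jacobian is invertible up to the boundary of
the reference cell. Compactness of that cell then bounds the weight from above. -/
lemma continuousOn_basisDeriv (v : K.kind.Vertex d) :
    ContinuousOn (K.basisDeriv v) (K.kind.refCell d) := by
  refine ContinuousOn.clm_comp
    ((K.kind.contDiff_shape v).continuous_fderiv one_ne_zero).continuousOn fun t ht => ?_
  set e := (fderiv ℝ (refMap K.kind K.vertex) t).toContinuousLinearEquivOfDetNeZero
    (K.det_ne_zero t ht) with he
  have h1 : ContinuousAt ContinuousLinearMap.inverse (fderiv ℝ (refMap K.kind K.vertex) t) :=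
    (contDiffAt_map_inverse (n := 0) e).continuousAt
  exact (h1.comp ((contDiff_refMap K.kind K.vertex).continuous_fderiv
    one_ne_zero).continuousAt).continuousWithinAt

/-- The inverse map is differentiable because it is continuous near `x` and is a right inverse of a
map with invertible derivative. It need not be known that `K.invMap x` is interior to the reference
cell. -/
lemma hasFDerivAt_basis (v : K.kind.Vertex d) {x : E d} (hx : x ∈ K.dom) :
    HasFDerivAt (K.basis v) (K.basisDeriv v (K.invMap x)) x := by
  have hxc := K.dom_subset hx
  have hn : K.carrier ∈ 𝓝 x := mem_interior_iff_mem_nhds.1 hx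
  set e := (fderiv ℝ (refMap K.kind K.vertex) (K.invMap x)).toContinuousLinearEquivOfDetNeZero
    (K.det_ne_zero _ (K.invMap_mem hxc)) with he
  have hF : HasFDerivAt (refMap K.kind K.vertex) (e : E d →L[ℝ] E d) (K.invMap x) :=
    ((contDiff_refMap K.kind K.vertex).differentiable one_ne_zero _).hasFDerivAt
  have hg : HasFDerivAt K.invMap (e.symm : E d →L[ℝ] E d) x :=
    HasFDerivAt.of_local_left_inverse (K.continuousOn_invMap.continuousAt hn) hF
      (Filter.mem_of_superset hn fun y hy => K.refMap_invMap hy)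
  have hs : HasFDerivAt (K.kind.shape d v) (fderiv ℝ (K.kind.shape d v) (K.invMap x))
      (K.invMap x) := ((K.kind.contDiff_shape v).differentiable one_ne_zero _).hasFDerivAt
  have h := hs.comp x hg
  have hinv : (fderiv ℝ (refMap K.kind K.vertex) (K.invMap x)).inverse =
      (e.symm : E d →L[ℝ] E d) := ContinuousLinearMap.inverse_equiv e
  rw [basisDeriv, hinv]
  exact h

lemma norm_gradient_basis (v : K.kind.Vertex d) (x : E d) :
    ‖gradient (K.basis v) x‖ = ‖fderiv ℝ (K.basis v) x‖ :=
  (InnerProductSpace.toDual ℝ (E d)).symm.norm_map _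

lemma vertex_mem (v : K.kind.Vertex d) : K.vertex v ∈ K.carrier := by
  obtain ⟨t, ht, h1, h0⟩ := K.kind.exists_node v
  refine ⟨t, ht, ?_⟩
  rw [refMap, Fintype.sum_eq_single v fun w hw => by rw [h0 w hw, zero_smul], h1, one_smul]

/-- Differentiate the identity `∑ η_v(y) (p_v - p) = y - p`, which combines the isoparametric form
of the element with the partition of unity. -/
lemma sum_fderiv_basis_apply {x : E d} (hx : x ∈ K.dom) (e p : E d) :
    ∑ v, fderiv ℝ (K.basis v) x e • (K.vertex v - p) = e := by
  have hd : ∀ v, HasFDerivAt (K.basis v) (fderiv ℝ (K.basis v) x) x := fun v =>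
    (K.hasFDerivAt_basis v hx).differentiableAt.hasFDerivAt
  have h1 : HasFDerivAt (fun y => ∑ v, K.basis v y • (K.vertex v - p))
      (∑ v, (fderiv ℝ (K.basis v) x).smulRight (K.vertex v - p)) x :=
    HasFDerivAt.fun_sum fun v _ => (hd v).smul_const _
  have h2 : (fun y => ∑ v, K.basis v y • (K.vertex v - p)) =ᶠ[𝓝 x] fun y => y - p := by
    refine Filter.mem_of_superset (K.isOpen_dom.mem_nhds hx) fun y hy => ?_
    have hF := K.refMap_invMap (K.dom_subset hy)
    have hS := K.kind.sum_shape (K.invMap y)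
    change ∑ v, K.kind.shape d v (K.invMap y) • (K.vertex v - p) = y - p
    simp only [smul_sub]
    rw [Finset.sum_sub_distrib, ← Finset.sum_smul, hS, one_smul]
    conv_rhs => rw [← hF]
    rfl
  have h3 : HasFDerivAt (fun y : E d => y - p) (ContinuousLinearMap.id ℝ (E d)) x :=
    (hasFDerivAt_id x).sub_const p
  have h4 := (h1.congr_of_eventuallyEq h2.symm).unique h3
  have h5 := congrArg (fun L : E d →L[ℝ] E d => L e) h4
  simpa using h5

/-- The weight is bounded below in terms of the diameter of the element. -/
lemma le_weight (hd : 1 ≤ d) (ε : ℝ) {x : E d} (hx : x ∈ K.dom) :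
    0 < Metric.diam K.carrier ∧
      ε ^ 2 / (2 * 2 ^ d * Metric.diam K.carrier ^ 2) ≤ K.weight ε x := by
  set D := Metric.diam K.carrier with hD
  have hD0 : 0 ≤ D := Metric.diam_nonneg
  obtain ⟨v₀⟩ : Nonempty (K.kind.Vertex d) := by
    by_contra h
    rw [not_nonempty_iff] at h
    have := K.kind.sum_shape (0 : E d)
    simp at this
  set e : E d := EuclideanSpace.single ⟨0, hd⟩ 1 with he
  have he1 : ‖e‖ = 1 := by simp [he]
  -- A unit vector is the sum of `∂ₑη_v (p_v - p_{v₀})`, and two vertices are at distance at most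
  -- `D`: the gradients cannot all be small on a small element.
  have hsum : 1 ≤ D * ∑ v, ‖gradient (K.basis v) x‖ := by
    rw [← he1, ← K.sum_fderiv_basis_apply hx e (K.vertex v₀), Finset.mul_sum]
    refine (norm_sum_le _ _).trans (Finset.sum_le_sum fun v _ => ?_)
    rw [norm_smul, K.norm_gradient_basis, mul_comm]
    refine mul_le_mul ?_ ?_ (norm_nonneg _) hD0
    · rw [← dist_eq_norm]
      exact Metric.dist_le_diam_of_mem K.isCompact_carrier.isBounded (K.vertex_mem v)
        (K.vertex_mem v₀)
    · simpa [he1] using (fderiv ℝ (K.basis v) x).le_opNorm e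
  have hDpos : 0 < D := by
    refine lt_of_le_of_ne hD0 fun h => ?_
    rw [← h, zero_mul] at hsum
    linarith
  refine ⟨hDpos, ?_⟩
  -- Cauchy-Schwarz over the vertices, at most `2 ^ d` for either kind of element; this is the
  -- source of the dimensional constant.
  have hcs : (∑ v, ‖gradient (K.basis v) x‖) ^ 2 ≤ 2 ^ d * ∑ v, ‖gradient (K.basis v) x‖ ^ 2 := by
    have hcard : ((Finset.univ : Finset (K.kind.Vertex d)).card : ℝ) ≤ 2 ^ d := by
      rw [Finset.card_univ]
      exact_mod_cast K.kind.card_vertex_le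
    exact (sq_sum_le_card_mul_sum_sq (s := Finset.univ)
      (f := fun v => ‖gradient (K.basis v) x‖)).trans
      (mul_le_mul_of_nonneg_right hcard (Finset.sum_nonneg fun v _ => sq_nonneg _))
  have hw : K.weight ε x = ε ^ 2 / 2 * ∑ v, ‖gradient (K.basis v) x‖ ^ 2 := by
    rw [weight, Finset.mul_sum]
  rw [hw, div_le_iff₀ (by positivity)]
  have h1 : 1 ≤ D ^ 2 * (2 ^ d * ∑ v, ‖gradient (K.basis v) x‖ ^ 2) := by
    calc (1 : ℝ) ≤ (D * ∑ v, ‖gradient (K.basis v) x‖) ^ 2 := one_le_pow₀ hsum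
      _ = D ^ 2 * (∑ v, ‖gradient (K.basis v) x‖) ^ 2 := mul_pow _ _ _
      _ ≤ _ := by gcongr
  nlinarith [mul_le_mul_of_nonneg_left h1 (sq_nonneg ε)]

lemma exists_weight_le (ε : ℝ) : ∃ C, ∀ x ∈ K.dom, K.weight ε x ≤ C := by
  choose B hB using fun v =>
    K.kind.isCompact_refCell.exists_bound_of_continuousOn (K.continuousOn_basisDeriv v)
  refine ⟨∑ v, ε ^ 2 / 2 * B v ^ 2, fun x hx => Finset.sum_le_sum fun v _ => ?_⟩
  rw [K.norm_gradient_basis, (K.hasFDerivAt_basis v hx).fderiv]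
  gcongr
  exact hB v _ (K.invMap_mem (K.dom_subset hx))

lemma measurable_weight (ε : ℝ) : Measurable (K.weight ε) := by
  unfold weight
  refine Finset.measurable_sum _ fun v _ => ?_
  simp only [K.norm_gradient_basis]
  exact (((measurable_fderiv ℝ (K.basis v)).norm).pow_const 2).const_mul _

lemma weight_nonneg (ε : ℝ) (x : E d) : 0 ≤ K.weight ε x :=
  Finset.sum_nonneg fun v _ => by positivity

end LagrangeCell

/-! ### The spectral gap on an element -/

namespace LagrangeCell

variable (K : LagrangeCell d)

/-- The lower bound 0 suffices on an element: in the eigenvalue problem coercivity comes from the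
energy form. -/
lemma exists_isBddWeight (ε : ℝ) : ∃ C, 0 < C ∧ IsBddWeight (K.weight ε) K.dom 0 C := by
  obtain ⟨C, hC⟩ := K.exists_weight_le ε
  refine ⟨max C 1, by positivity, (K.measurable_weight ε).aemeasurable,
    Eventually.of_forall (K.weight_nonneg ε), ?_⟩
  filter_upwards [ae_restrict_mem K.isOpen_dom.measurableSet] with x hx
  exact (hC x hx).trans (le_max_left _ _)

end LagrangeCell

namespace IsEigensystem

variable {ε : ℝ} {V : E d → ℝ} {K : LagrangeCell d} {lam : ℕ → ℝ} {φ : ℕ → Pair K.dom}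

/-- Testing the eigenvalue equation with `φ i` makes `lam i * s(φ i, φ i)` equal to a positive
energy; as `s` is nonnegative, both factors are positive. -/
lemma pos (h : IsEigensystem ε V K lam φ) (hε : 0 < ε) {c C : ℝ} (hc : 0 < c)
    (hV : IsBddWeight V K.dom c C) (i : ℕ) :
    0 < (sForm (K.weight ε) K.dom (φ i).fst (φ i).fst).re ∧ 0 < lam i := by
  obtain ⟨C', -, hμ⟩ := K.exists_isBddWeight ε
  have h1 := (h.eig i).2 (φ i) (h.eig i).1
  have h2 := le_aForm_self hV hc.le ε (φ i)
  have h3 : 0 < min (ε ^ 2 / 2) c * ‖φ i‖ ^ 2 := by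
    have := norm_pos_iff.2 (h.ne_zero i)
    have : 0 < min (ε ^ 2 / 2) c := lt_min (by positivity) hc
    positivity
  rw [h1, Complex.re_ofReal_mul] at h2
  have h4 := (hμ.isHermForm le_rfl).nonneg (φ i).fst
  have h5 : 0 < lam i * (sForm (K.weight ε) K.dom (φ i).fst (φ i).fst).re := h3.trans_le h2
  have h6 : 0 < (sForm (K.weight ε) K.dom (φ i).fst (φ i).fst).re :=
    lt_of_le_of_ne h4 fun h0 => by rw [← h0, mul_zero] at h5; exact lt_irrefl _ h5
  exact ⟨h6, pos_of_mul_pos_left h5 h4⟩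

/-- The Rayleigh quotient on the complement of the first `l` eigenfunctions is at least the next
eigenvalue. -/
theorem le_aForm (h : IsEigensystem ε V K lam φ) (hε : 0 < ε) {c C : ℝ} (hc : 0 < c)
    (hV : IsBddWeight V K.dom c C) {l : ℕ} {w : Pair K.dom} (hw : w ∈ H1 K.dom)
    (horth : ∀ i < l, sForm (K.weight ε) K.dom w.fst (φ i).fst = 0) :
    lam l * (sForm (K.weight ε) K.dom w.fst w.fst).re ≤ (aForm ε V w w).re := by
  obtain ⟨B, hB, hμ⟩ := K.exists_isBddWeight ε
  have hA := isHermForm_aForm hV hc.le ε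
  set S : Pair K.dom → Pair K.dom → ℂ := fun u v => sForm (K.weight ε) K.dom u.fst v.fst with hSdef
  have hS : IsHermForm S := (hμ.isHermForm le_rfl).comap (Pair.fstₗ K.dom)
  have hS_fst : ∀ u, (S u u).re ≤ B * ‖u.fst‖ ^ 2 := fun u => hμ.sForm_self_le le_rfl u.fst
  have hS_upper : ∀ u, (S u u).re ≤ B * ‖u‖ ^ 2 := fun u => (hS_fst u).trans (by
    rw [Pair.norm_sq]
    exact mul_le_mul_of_nonneg_left (by linarith [sq_nonneg ‖u.snd‖]) hB.le)
  have hcA : 0 < min (ε ^ 2 / 2) c := lt_min (by positivity) hc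
  obtain ⟨W₁, hW₁, hW₁c⟩ := exists_closed_submodule_H1 K.isOpen_dom.measurableSet K.isBounded_dom
  have hmem : ∀ v, v ∈ W₁ ↔ v ∈ H1 K.dom := fun v => by rw [← hW₁]; rfl
  -- The closed subspace of `H¹(K)` that is `s`-orthogonal to the first `l` eigenfunctions.
  set W : Submodule ℂ (Pair K.dom) :=
    W₁ ⊓ ⨅ i : Fin l, LinearMap.ker (hS.toCLM hB.le hS_upper (φ i)).toLinearMap with hW
  have hWmem : ∀ v, v ∈ W ↔ v ∈ H1 K.dom ∧ ∀ i < l, S v (φ i) = 0 := fun v => by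
    rw [hW, Submodule.mem_inf, hmem, Submodule.mem_iInf]
    exact and_congr_right fun _ => ⟨fun hi i hil => hi ⟨i, hil⟩, fun hi i => hi i i.2⟩
  have hWc : IsClosed (W : Set (Pair K.dom)) := by
    rw [hW, Submodule.coe_inf, Submodule.coe_iInf]
    exact hW₁c.inter (isClosed_iInter fun i => (hS.toCLM hB.le hS_upper (φ i)).isClosed_ker)
  have hcomp : ∀ δ : ℝ, 0 < δ → ∃ (ι : Type) (_ : Fintype ι) (ℓ : ι → Pair K.dom →L[ℂ] ℂ),
      ∀ v ∈ W, (S v v).re ≤ δ * ‖v‖ ^ 2 + ∑ k, ‖ℓ k v‖ ^ 2 := by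
    intro δ hδ
    obtain ⟨ι, _, ℓ, hℓ⟩ := H1.exists_functionals K.isOpen_dom K.convex_dom K.isBounded_dom
      (div_pos hδ hB)
    refine ⟨ι, inferInstance, fun k => (Real.sqrt B : ℂ) • ℓ k, fun v hv => (hS_fst v).trans ?_⟩
    have h1 := mul_le_mul_of_nonneg_left (hℓ v ((hWmem v).1 hv).1) hB.le
    refine h1.trans (le_of_eq ?_)
    rw [mul_add, Finset.mul_sum]
    congr 1
    · field_simp
    · refine Finset.sum_congr rfl fun k _ => ?_
      rw [smul_apply, norm_smul, mul_pow, Complex.norm_real, Real.norm_eq_abs,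
        sq_abs, Real.sq_sqrt hB.le]
  by_contra hlt
  push Not at hlt
  have hwW : w ∈ W := (hWmem w).2 ⟨hw, horth⟩
  have hSw : 0 < (S w w).re := by
    refine lt_of_le_of_ne (hS.nonneg w) fun h0 => ?_
    change (aForm ε V w w).re < lam l * (S w w).re at hlt
    rw [← h0, mul_zero] at hlt
    exact absurd (hA.nonneg w) (not_le.2 hlt)
  obtain ⟨M, hM, hle, w₀, hw₀, hw₀0, hw₀eq⟩ := exists_rayleigh_maximizer hA hS hcA
    (show 0 ≤ max (ε ^ 2 / 2) C by positivity) hB.le (le_aForm_self hV hc.le ε)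
    (aForm_self_le hV hc.le ε) hS_upper W hWc hcomp ⟨w, hwW, hSw⟩
  -- The offending `w` satisfies `A < lam l * S` and `S ≤ M * A` on the diagonal, which forces `M *
  -- lam l > 1`.
  have hr : M⁻¹ < lam l := by
    have h1 := hle w hwW
    have h2 : (S w w).re < M * (lam l * (S w w).re) := h1.trans_lt (mul_lt_mul_of_pos_left hlt hM)
    have h3 : 1 < M * lam l := by
      by_contra h4
      push Not at h4
      nlinarith
    rwa [inv_lt_iff_one_lt_mul₀' hM]
  obtain ⟨hw₀H, hw₀S⟩ := (hWmem w₀).1 hw₀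
  have hSφ : ∀ i, S (φ i) (φ i) ≠ 0 := fun i h0 => by
    have := (h.pos hε hc hV i).1
    change 0 < (S (φ i) (φ i)).re at this
    rw [h0] at this
    exact lt_irrefl _ this
  -- The maximizer satisfies its equation only against `W`. Any `v ∈ H¹(K)` differs from an element
  -- of `W` by its projection `p` onto the first `l` eigenfunctions, and both forms vanish at `(w₀,
  -- p)`.
  have hsolve : SolvesEig ε V K M⁻¹ w₀ := by
    refine ⟨hw₀H, fun v hv => ?_⟩
    set p : Pair K.dom := ∑ i ∈ Finset.range l, (S v (φ i) / S (φ i) (φ i)) • φ i with hp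
    have hpH : p ∈ W₁ := W₁.sum_mem fun i _ => W₁.smul_mem _ ((hmem _).2 (h.eig i).1)
    have hvp : v - p ∈ W := by
      refine (hWmem _).2 ⟨(hmem _).1 (W₁.sub_mem ((hmem _).2 hv) hpH), fun i hi => ?_⟩
      rw [hS.sub_left, hp, hS.sum_left, Finset.sum_eq_single i]
      · rw [hS.smul_left, div_mul_cancel₀ _ (hSφ i), sub_self]
      · intro k _ hki
        rw [hS.smul_left]
        have : S (φ k) (φ i) = 0 := h.orthogonal k i hki
        rw [this, mul_zero]
      · intro hi'
        exact absurd (Finset.mem_range.2 hi) hi'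
    have hS0 : S w₀ p = 0 := by
      rw [← hS.conj_symm, hp, hS.sum_left, Finset.sum_eq_zero, map_zero]
      intro i hi
      rw [hS.smul_left, ← hS.conj_symm (φ i) w₀, hw₀S i (Finset.mem_range.1 hi), map_zero, mul_zero]
    have hA0 : aForm ε V w₀ p = 0 := by
      rw [← hA.conj_symm, hp, hA.sum_left, Finset.sum_eq_zero, map_zero]
      intro i hi
      have h1 : aForm ε V (φ i) w₀ = lam i * S (φ i) w₀ := (h.eig i).2 w₀ hw₀H
      rw [hA.smul_left, h1, ← hS.conj_symm (φ i) w₀, hw₀S i (Finset.mem_range.1 hi), map_zero,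
        mul_zero, mul_zero]
    have h1 := hw₀eq (v - p) hvp
    rw [hS.sub_right, hA.sub_right, hS0, hA0, sub_zero, sub_zero] at h1
    change aForm ε V w₀ v = _ * S w₀ v
    rw [h1]
    have : (M : ℂ) ≠ 0 := by exact_mod_cast hM.ne'
    push_cast
    field_simp
  have hspan := h.all _ _ hsolve
  have hker : Submodule.span ℂ {ψ | ∃ i, lam i = M⁻¹ ∧ φ i = ψ} ≤ LinearMap.ker (hS.linear w₀) := by
    refine Submodule.span_le.2 ?_
    rintro _ ⟨i, hi, rfl⟩
    -- Monotonicity: an eigenvalue strictly below `lam l` can only have an index below `l`. Thus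
    -- `w₀` lies in the span of functions orthogonal to it.
    have hil : i < l := by
      by_contra hil
      have := h.mono (not_lt.1 hil)
      rw [hi] at this
      exact absurd hr (not_lt.2 this)
    change S (φ i) w₀ = 0
    rw [← hS.conj_symm, hw₀S i hil, map_zero]
  have h0 : S w₀ w₀ = 0 := hker hspan
  have h1 := hw₀eq w₀ hw₀
  rw [h0, hA.self_eq, ← Complex.ofReal_mul] at h1
  have h2 : M * (aForm ε V w₀ w₀).re = 0 := by exact_mod_cast h1.symm
  have h3 := le_aForm_self hV hc.le ε w₀
  have h4 : 0 < min (ε ^ 2 / 2) c * ‖w₀‖ ^ 2 := by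
    have := norm_pos_iff.2 hw₀0
    positivity
  rcases mul_eq_zero.1 h2 with h5 | h5 <;> linarith

end IsEigensystem

/-! ### Coarse meshes of a box -/

lemma isOpen_box (a b : Fin d → ℝ) : IsOpen (box a b) := by
  have h : box a b = ⋂ i, {x : E d | a i < x i} ∩ {x | x i < b i} := by
    ext x; simp [box]
  rw [h]
  refine isOpen_iInter_of_finite fun i => IsOpen.inter ?_ ?_
  · exact isOpen_lt continuous_const (CellKind.contDiff_coord i).continuous
  · exact isOpen_lt (CellKind.contDiff_coord i).continuous continuous_const

lemma convex_box (a b : Fin d → ℝ) : Convex ℝ (box a b) := by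
  intro x hx y hy s t hs ht hst i
  have h1 := convex_Ioo (a i) (b i) (hx i) (hy i) hs ht hst
  simpa using h1

lemma isBounded_box (a b : Fin d → ℝ) : Bornology.IsBounded (box a b) := by
  refine (Metric.isBounded_closedBall (x := (0 : E d))
    (r := Real.sqrt (∑ i, (max |a i| |b i|) ^ 2))).subset fun x hx => ?_
  rw [mem_closedBall_zero_iff, EuclideanSpace.norm_eq]
  refine Real.sqrt_le_sqrt (Finset.sum_le_sum fun i _ => ?_)
  refine pow_le_pow_left₀ (norm_nonneg _) ?_ 2
  exact abs_le_max_abs_abs (hx i).1.le (hx i).2.le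

lemma nonempty_box {a b : Fin d → ℝ} (hab : ∀ i, a i < b i) : (box a b).Nonempty :=
  ⟨WithLp.toLp 2 fun i => (a i + b i) / 2, fun i => by
    have := hab i
    constructor <;> simp only <;> linarith⟩

namespace CoarseMesh

variable {a b : Fin d → ℝ} (T : CoarseMesh (box a b))

/-- An element lies in the closed box, and a nonempty open convex set is the interior of its
closure. -/
lemma dom_subset (hab : ∀ i, a i < b i) (j : Fin T.N) : (T.cell j).dom ⊆ box a b := by
  have h1 : (T.cell j).carrier ⊆ closure (box a b) := by
    rw [← T.cover]
    exact Set.subset_iUnion (fun j => (T.cell j).carrier) j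
  have h2 : interior (closure (box a b)) = box a b := by
    rw [(convex_box a b).interior_closure_eq_interior_of_nonempty_interior
      (by rw [(isOpen_box a b).interior_eq]; exact nonempty_box hab), (isOpen_box a b).interior_eq]
  exact (interior_mono h1).trans h2.subset

/-- Frontiers of convex sets are null, so the mesh skeleton is negligible. -/
lemma ae_mem_dom : ∀ᵐ x ∂volume.restrict (box a b), ∃ j, x ∈ (T.cell j).dom := by
  have h : ∀ j, ∀ᵐ x ∂volume.restrict (box a b), x ∉ frontier (T.cell j).carrier := fun j =>
    ae_restrict_of_ae (measure_eq_zero_iff_ae_notMem.1 ((T.cell j).convex.addHaar_frontier volume))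
  filter_upwards [ae_all_iff.2 h, ae_restrict_mem (isOpen_box a b).measurableSet] with x hx hxb
  have hxc : x ∈ ⋃ j, (T.cell j).carrier := by
    rw [T.cover]
    exact subset_closure hxb
  obtain ⟨j, hj⟩ := Set.mem_iUnion.1 hxc
  refine ⟨j, ?_⟩
  by_contra hxd
  exact hx j ⟨subset_closure hj, hxd⟩

lemma weight_eq (ε : ℝ) {j : Fin T.N} {x : E d} (hx : x ∈ (T.cell j).dom) :
    T.weight ε x = (T.cell j).weight ε x := by
  rw [weight, Finset.sum_eq_single j, Set.indicator_of_mem hx]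
  · intro k _ hkj
    exact Set.indicator_of_notMem (Set.disjoint_left.1 (T.disjoint j k hkj.symm) hx) _
  · exact fun h => absurd (Finset.mem_univ j) h

lemma diam_le_size (j : Fin T.N) : Metric.diam (T.cell j).carrier ≤ T.size :=
  le_ciSup (f := fun j => Metric.diam (T.cell j).carrier) (Set.finite_range _).bddAbove j

lemma isBddWeight (hd : 1 ≤ d) (ε : ℝ) :
    ∃ C, IsBddWeight (T.weight ε) (box a b) (ε ^ 2 / (2 * 2 ^ d * T.size ^ 2)) C := by
  choose C hC0 hC using fun j => (T.cell j).exists_weight_le ε |>.imp fun C hC =>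
    (⟨le_max_right C 0, fun x hx => (hC x hx).trans (le_max_left C 0)⟩ :
      0 ≤ max C 0 ∧ ∀ x ∈ (T.cell j).dom, (T.cell j).weight ε x ≤ max C 0)
  refine ⟨∑ j, max (C j) 0, ?_, ?_, ?_⟩
  · refine Measurable.aemeasurable ?_
    unfold weight
    exact Finset.measurable_sum _ fun j _ =>
      ((T.cell j).measurable_weight ε).indicator (T.cell j).isOpen_dom.measurableSet
  · filter_upwards [T.ae_mem_dom] with x ⟨j, hx⟩
    rw [T.weight_eq ε hx]
    obtain ⟨hpos, hle⟩ := (T.cell j).le_weight hd ε hx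
    refine le_trans ?_ hle
    have := T.diam_le_size j
    gcongr
  · filter_upwards [T.ae_mem_dom] with x ⟨j, hx⟩
    rw [T.weight_eq ε hx]
    exact (hC j x hx).trans
      (Finset.single_le_sum (f := fun j => max (C j) 0) (fun j _ => hC0 j) (Finset.mem_univ j))

lemma setIntegral_eq_sum {F : Type*} [NormedAddCommGroup F] [NormedSpace ℝ F]
    (hab : ∀ i, a i < b i) {g : E d → F} (hg : IntegrableOn g (box a b)) :
    ∫ x in box a b, g x = ∑ j, ∫ x in (T.cell j).dom, g x := by
  have hae : (box a b : Set (E d)) =ᵐ[volume] ⋃ j, (T.cell j).dom := by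
    refine Filter.EventuallyLE.antisymm ?_
      (Eventually.of_forall fun x hx => Set.iUnion_subset (fun j => T.dom_subset hab j) hx)
    have h := (ae_restrict_iff' (isOpen_box a b).measurableSet).1 T.ae_mem_dom
    filter_upwards [h] with x hx hxb
    exact Set.mem_iUnion.2 (hx hxb)
  rw [setIntegral_congr_set hae]
  exact integral_iUnion_fintype (fun j => (T.cell j).isOpen_dom.measurableSet)
    (fun i j hij => T.disjoint i j hij) fun j => hg.mono_set (T.dom_subset hab j)

lemma nonempty_fin (hab : ∀ i, a i < b i) : Nonempty (Fin T.N) := by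
  obtain ⟨x, hx⟩ := nonempty_box hab
  have h : x ∈ ⋃ j, (T.cell j).carrier := by rw [T.cover]; exact subset_closure hx
  obtain ⟨j, -⟩ := Set.mem_iUnion.1 h
  exact ⟨j⟩

lemma size_pos (hd : 1 ≤ d) (hab : ∀ i, a i < b i) : 0 < T.size := by
  have hne : (ae (volume.restrict (box a b))).NeBot := by
    rw [ae_neBot, Ne, Measure.restrict_eq_zero]
    exact ((isOpen_box a b).measure_pos volume (nonempty_box hab)).ne'
  -- Any point in an open element will do; the weight parameter 1 is irrelevant, since only
  -- positivity of the diameter is used.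
  obtain ⟨x, j, hx⟩ := T.ae_mem_dom.exists
  exact ((T.cell j).le_weight hd 1 hx).1.trans_le (T.diam_le_size j)

end CoarseMesh

/-! ### The global multiscale space -/

/-- The Hermitian form `∑ n_α c_α(x) conj c_α(y)`. -/
lemma isHermForm_sum {X A : Type*} [AddCommGroup X] [Module ℂ X] [Fintype A] {n : A → ℝ}
    (hn : ∀ α, 0 ≤ n α) (c : A → X →ₗ[ℂ] ℂ) :
    IsHermForm fun x y => ∑ α, (n α : ℂ) * c α x * conj (c α y) where
  add_left x y z := by
    rw [← Finset.sum_add_distrib]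
    exact Finset.sum_congr rfl fun α _ => by rw [map_add]; ring
  smul_left r x y := by
    rw [Finset.mul_sum]
    exact Finset.sum_congr rfl fun α _ => by rw [map_smul, smul_eq_mul]; ring
  conj_symm x y := by
    rw [map_sum]
    refine Finset.sum_congr rfl fun α _ => ?_
    simp only [map_mul, Complex.conj_ofReal, Complex.conj_conj]
    ring
  nonneg x := by
    rw [Complex.re_sum]
    refine Finset.sum_nonneg fun α _ => ?_
    rw [mul_assoc, Complex.mul_conj, ← Complex.ofReal_mul, Complex.ofReal_re]
    exact mul_nonneg (hn α) (Complex.normSq_nonneg _)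

/-- An element that is orthogonal to all solutions of the global problems is annihilated by all
the coefficient functionals. -/
theorem coeff_eq_zero_of_orthogonal {X A : Type*} [NormedAddCommGroup X] [NormedSpace ℂ X]
    [CompleteSpace X] [Fintype A] {a : X → X → ℂ} (ha : IsHermForm a) {c₀ C₀ : ℝ} (hc₀ : 0 < c₀)
    (hC₀ : 0 ≤ C₀) (ha_lower : ∀ x, c₀ * ‖x‖ ^ 2 ≤ (a x x).re)
    (ha_upper : ∀ x, (a x x).re ≤ C₀ * ‖x‖ ^ 2) (W : Submodule ℂ X) (hW : IsClosed (W : Set X))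
    {n : A → ℝ} (hn : ∀ α, 0 < n α) (c : A → X →L[ℂ] ℂ) {e : X} (he : e ∈ W)
    (horth : ∀ α, ∀ ψ ∈ W, (∀ v ∈ W, a ψ v + ∑ β, (n β : ℂ) * c β ψ * conj (c β v) =
      n α * conj (c α v)) → a e ψ = 0) (α : A) : c α e = 0 := by
  set P : X → X → ℂ := fun x y => ∑ β, (n β : ℂ) * c β x * conj (c β y) with hPdef
  have hP : IsHermForm P := isHermForm_sum (fun β => (hn β).le) fun β => (c β).toLinearMap
  have hP_self : ∀ x, (P x x).re = ∑ β, n β * ‖c β x‖ ^ 2 := fun x => by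
    rw [hPdef, Complex.re_sum]
    refine Finset.sum_congr rfl fun β _ => ?_
    rw [mul_assoc, Complex.mul_conj, ← Complex.ofReal_mul, Complex.ofReal_re,
      Complex.normSq_eq_norm_sq]
  have hP_upper : ∀ x, (P x x).re ≤ (∑ β, n β * ‖c β‖ ^ 2) * ‖x‖ ^ 2 := fun x => by
    rw [hP_self, Finset.sum_mul]
    refine Finset.sum_le_sum fun β _ => ?_
    rw [mul_assoc, ← mul_pow]
    exact mul_le_mul_of_nonneg_left (pow_le_pow_left₀ (norm_nonneg _) ((c β).le_opNorm x) 2)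
      (hn β).le
  have hsum0 : 0 ≤ ∑ β, n β * ‖c β‖ ^ 2 :=
    Finset.sum_nonneg fun β _ => mul_nonneg (hn β).le (sq_nonneg _)
  -- Existence of the basis functions has to be proved, since `V_glo` is only the span of those
  -- solutions that exist. Adding the finite-rank nonnegative `P` keeps the form bounded and
  -- coercive.
  have hψ : ∀ α, ∃ ψ ∈ W, ∀ v ∈ W, a ψ v + P ψ v = n α * conj (c α v) := by
    intro α
    obtain ⟨ψ, hψ, h⟩ := exists_riesz_representative (ha.add hP) hc₀ (add_nonneg hC₀ hsum0)
      (fun x => (ha_lower x).trans (by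
        rw [Complex.add_re]
        exact le_add_of_nonneg_right (hP.nonneg x)))
      (fun x => by
        rw [Complex.add_re, add_mul]
        exact add_le_add (ha_upper x) (hP_upper x)) W hW ((n α : ℂ) • c α)
    refine ⟨ψ, hψ, fun v hv => (h v hv).trans ?_⟩
    simp
  choose ψ hψW hψeq using hψ
  -- By linearity `Ψ` solves the global problem with right-hand side `P e v`, and it is
  -- `a`-orthogonal to `e`.
  set Ψ : X := ∑ α, c α e • ψ α with hΨ
  have hΨW : Ψ ∈ W := W.sum_mem fun α _ => W.smul_mem _ (hψW α)
  have hΨeq : ∀ v ∈ W, a Ψ v + P Ψ v = P e v := by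
    intro v hv
    have h1 := (ha.add hP).sum_left Finset.univ (fun α => c α e • ψ α) v
    rw [← hΨ] at h1
    rw [h1]
    refine Finset.sum_congr rfl fun α _ => ?_
    rw [ha.smul_left, hP.smul_left, ← mul_add, hψeq α v hv]
    ring
  have haΨ : a Ψ e = 0 := by
    rw [hΨ, ha.sum_left]
    refine Finset.sum_eq_zero fun α _ => ?_
    rw [ha.smul_left, ← ha.conj_symm, horth α _ (hψW α) (hψeq α), map_zero, mul_zero]
  have h1 := hΨeq e he
  have h2 := hΨeq Ψ hΨW
  rw [haΨ, zero_add] at h1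
  have h3 : P e Ψ = P e e := by rw [← hP.conj_symm, h1, hP.conj_symm]
  -- Testing with `e` gives `P Ψ e = P e e`, so `0 ≤ P (Ψ - e) (Ψ - e) = P Ψ Ψ - P e e = -a Ψ Ψ`.
  -- Coercivity then gives `Ψ = 0`, and `P e e = P Ψ e = 0`.
  have h4 := hP.nonneg (Ψ - e)
  rw [hP.sub_left, hP.sub_right, hP.sub_right, h1, h3, sub_self, sub_zero, Complex.sub_re] at h4
  have h5 := congrArg Complex.re h2
  rw [h3, Complex.add_re] at h5
  have h6 := ha_lower Ψ
  have hΨ0 : Ψ = 0 := by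
    have : c₀ * ‖Ψ‖ ^ 2 ≤ 0 := by linarith
    have h7 : ‖Ψ‖ ^ 2 ≤ 0 := by
      by_contra h8
      push Not at h8
      exact absurd this (not_le.2 (mul_pos hc₀ h8))
    simpa using le_antisymm h7 (sq_nonneg _)
  have h7 : ∑ β, n β * ‖c β e‖ ^ 2 = 0 := by
    rw [← hP_self, ← h1, hΨ0, hP.zero_left, Complex.zero_re]
  have h8 := (Finset.sum_eq_zero_iff_of_nonneg
    fun β _ => mul_nonneg (hn β).le (sq_nonneg _)).1 h7 α (Finset.mem_univ _)
  rcases mul_eq_zero.1 h8 with h9 | h9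
  · exact absurd h9 (hn α).ne'
  · simpa using h9

section Aux

variable {a b : Fin d → ℝ} (T : CoarseMesh (box a b)) {ε : ℝ}
  (φ : (j : Fin T.N) → ℕ → Pair (T.cell j).dom)

/-- Extension by zero confines the product to one element, where the global and local weights agree.
This links the global projection to the local eigenvalue problems. -/
lemma sForm_phiExt_right (hab : ∀ i, a i < b i) (j : Fin T.N) (i : ℕ) (v : E d → ℂ) :
    sForm (T.weight ε) (box a b) v (phiExt T φ j i) =
      sForm ((T.cell j).weight ε) (T.cell j).dom v (φ j i).fst := by
  rw [sForm, sForm, setIntegral_eq_of_subset_of_forall_sdiff_eq_zero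
    (isOpen_box a b).measurableSet (T.dom_subset hab j)]
  · refine setIntegral_congr_fun (T.cell j).isOpen_dom.measurableSet fun x hx => ?_
    rw [T.weight_eq ε hx, phiExt, Set.indicator_of_mem hx]
  · intro x hx
    rw [phiExt, Set.indicator_of_notMem hx.2, map_zero, mul_zero]

lemma sForm_phiExt_self (hab : ∀ i, a i < b i) (j : Fin T.N) (i k : ℕ) :
    sForm (T.weight ε) (box a b) (phiExt T φ j k) (phiExt T φ j i) =
      sForm ((T.cell j).weight ε) (T.cell j).dom (φ j k).fst (φ j i).fst := by
  rw [sForm_phiExt_right T φ hab]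
  refine sForm_congr ?_ EventuallyEq.rfl
  filter_upwards [ae_restrict_mem (T.cell j).isOpen_dom.measurableSet] with x hx
  rw [phiExt, Set.indicator_of_mem hx]

lemma sForm_phiExt_of_ne (hab : ∀ i, a i < b i) {j k : Fin T.N} (hjk : j ≠ k) (i m : ℕ) :
    sForm (T.weight ε) (box a b) (phiExt T φ j i) (phiExt T φ k m) = 0 := by
  rw [sForm_phiExt_right T φ hab, sForm]
  refine setIntegral_eq_zero_of_forall_eq_zero fun x hx => ?_
  rw [phiExt, Set.indicator_of_notMem (Set.disjoint_right.1 (T.disjoint j k hjk) hx), mul_zero,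
    zero_mul]

lemma memLp_phiExt (hab : ∀ i, a i < b i) (j : Fin T.N) (i : ℕ) :
    MemLp (phiExt T φ j i) 2 (volume.restrict (box a b)) := by
  rw [phiExt, memLp_indicator_iff_restrict (T.cell j).isOpen_dom.measurableSet,
    Measure.restrict_restrict (T.cell j).isOpen_dom.measurableSet,
    Set.inter_eq_left.2 (T.dom_subset hab j)]
  exact fst_memLp _

/-- The extended eigenfunctions as elements of `L²`. -/
noncomputable def phiLp (hab : ∀ i, a i < b i) (j : Fin T.N) (i : ℕ) : L2 (box a b) :=
  (memLp_phiExt T φ hab j i).toLp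

lemma coeFn_phiLp (hab : ∀ i, a i < b i) (j : Fin T.N) (i : ℕ) :
    phiLp T φ hab j i =ᵐ[volume.restrict (box a b)] phiExt T φ j i :=
  (memLp_phiExt T φ hab j i).coeFn_toLp

/-- The auxiliary projection as an element of `L²`. -/
lemma auxProj_ae_eq (hab : ∀ i, a i < b i) (l : Fin T.N → ℕ) (v : E d → ℂ) :
    auxProj T ε φ l v =ᵐ[volume.restrict (box a b)]
      (∑ α : (j : Fin T.N) × Fin (l j), (sForm (T.weight ε) (box a b) v (phiExt T φ α.1 α.2) /
        sForm (T.weight ε) (box a b) (phiExt T φ α.1 α.2) (phiExt T φ α.1 α.2)) •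
          phiLp T φ hab α.1 α.2 : L2 (box a b)) := by
  refine EventuallyEq.trans ?_ (Lp.coeFn_finsetSum _ _).symm
  have h1 : ∀ᵐ x ∂volume.restrict (box a b), ∀ α : (j : Fin T.N) × Fin (l j),
      phiLp T φ hab α.1 α.2 x = phiExt T φ α.1 α.2 x :=
    ae_all_iff.2 fun α => coeFn_phiLp T φ hab α.1 α.2
  have h2 : ∀ᵐ x ∂volume.restrict (box a b), ∀ α : (j : Fin T.N) × Fin (l j),
      ((sForm (T.weight ε) (box a b) v (phiExt T φ α.1 α.2) /
        sForm (T.weight ε) (box a b) (phiExt T φ α.1 α.2) (phiExt T φ α.1 α.2)) •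
          phiLp T φ hab α.1 α.2 : L2 (box a b)) x =
      (sForm (T.weight ε) (box a b) v (phiExt T φ α.1 α.2) /
        sForm (T.weight ε) (box a b) (phiExt T φ α.1 α.2) (phiExt T φ α.1 α.2)) •
          phiLp T φ hab α.1 α.2 x :=
    ae_all_iff.2 fun α => Lp.coeFn_smul _ _
  filter_upwards [h1, h2] with x hx1 hx2
  rw [Finset.sum_apply]
  simp only [hx2, hx1]
  rw [auxProj, Fintype.sum_sigma]
  refine Finset.sum_congr rfl fun j _ => ?_
  rw [Finset.sum_range]
  rfl

end Aux

/-- The form of two orthogonal expansions. -/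
lemma IsHermForm.orthogonal_expansion {X A : Type*} [AddCommGroup X] [Module ℂ X] [Fintype A]
    {S : X → X → ℂ} (hS : IsHermForm S) {Φ : A → X} {n : A → ℝ}
    (hself : ∀ α, S (Φ α) (Φ α) = n α) (hne : ∀ α β, α ≠ β → S (Φ α) (Φ β) = 0) (p q : A → ℂ) :
    (∀ α, S (Φ α) (∑ β, q β • Φ β) = n α * conj (q α)) ∧
      S (∑ α, p α • Φ α) (∑ β, q β • Φ β) = ∑ α, (n α : ℂ) * p α * conj (q α) := by
  have h1 : ∀ α, S (Φ α) (∑ β, q β • Φ β) = n α * conj (q α) := fun α => by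
    rw [← hS.conj_symm, hS.sum_left, Finset.sum_eq_single α]
    · rw [hS.smul_left, hself, map_mul, Complex.conj_ofReal, mul_comm]
    · intro β _ hβ
      rw [hS.smul_left, hne β α hβ, mul_zero]
    · exact fun h => absurd (Finset.mem_univ α) h
  refine ⟨h1, ?_⟩
  rw [hS.sum_left]
  refine Finset.sum_congr rfl fun α _ => ?_
  rw [hS.smul_left, h1]
  ring

/-! ### Orthogonality of the Galerkin error and the global spectral gap -/

section Error

variable {a b : Fin d → ℝ} (T : CoarseMesh (box a b)) {ε : ℝ} {V : E d → ℝ} {Vmin Vmax : ℝ}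
  {lam : Fin T.N → ℕ → ℝ} {φ : (j : Fin T.N) → ℕ → Pair (T.cell j).dom} {l : Fin T.N → ℕ}

/-- A periodic Sobolev function that is `a`-orthogonal to the multiscale space is `s`-orthogonal
to the auxiliary space. -/
theorem sForm_phiExt_eq_zero_of_orthogonal (hd : 1 ≤ d) (hab : ∀ i, a i < b i) (hε : 0 < ε)
    (hVmin : 0 < Vmin) (hV : IsBddWeight V (box a b) Vmin Vmax)
    (hφ : ∀ j, IsEigensystem ε V (T.cell j) (lam j) (φ j)) {e : Pair (box a b)}
    (he : e ∈ H1P a b) (horth : ∀ ψ ∈ Vglo T ε V φ l, ψ ∈ H1P a b → aForm ε V e ψ = 0)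
    (j : Fin T.N) {i : ℕ} (hi : i < l j) :
    sForm (T.weight ε) (box a b) e.fst (phiExt T φ j i) = 0 := by
  obtain ⟨C, hμ⟩ := T.isBddWeight hd ε
  have hc0 : 0 ≤ ε ^ 2 / (2 * 2 ^ d * T.size ^ 2) := by positivity
  set μ := T.weight ε
  have hS := hμ.isHermForm hc0
  have hC : ∀ u : L2 (box a b), (sForm μ (box a b) u u).re ≤ max C 0 * ‖u‖ ^ 2 := fun u =>
    (hμ.sForm_self_le hc0 u).trans (mul_le_mul_of_nonneg_right (le_max_left _ _) (sq_nonneg _))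
  set A := (j : Fin T.N) × Fin (l j)
  set Φ : A → L2 (box a b) := fun α => phiLp T φ hab α.1 α.2 with hΦ
  set n : A → ℝ := fun α =>
    (sForm ((T.cell α.1).weight ε) (T.cell α.1).dom (φ α.1 α.2).fst (φ α.1 α.2).fst).re with hn
  have hVc : ∀ j, IsBddWeight V (T.cell j).dom Vmin Vmax := fun j =>
    hV.mono_set (T.dom_subset hab j)
  have hnpos : ∀ α, 0 < n α := fun α => ((hφ α.1).pos hε hVmin (hVc α.1) α.2).1
  have hself' : ∀ α : A, sForm μ (box a b) (phiExt T φ α.1 α.2) (phiExt T φ α.1 α.2) = n α := by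
    intro α
    obtain ⟨B, -, hB⟩ := (T.cell α.1).exists_isBddWeight ε
    rw [sForm_phiExt_self T φ hab]
    exact (hB.isHermForm le_rfl).self_eq (φ α.1 α.2).fst
  have hΦae : ∀ α, Φ α =ᵐ[volume.restrict (box a b)] phiExt T φ α.1 α.2 := fun α =>
    coeFn_phiLp T φ hab α.1 α.2
  have hself : ∀ α, sForm μ (box a b) (Φ α) (Φ α) = n α := fun α => by
    rw [sForm_congr (hΦae α) (hΦae α), hself']
  have hne : ∀ α β, α ≠ β → sForm μ (box a b) (Φ α) (Φ β) = 0 := by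
    rintro ⟨j, i⟩ ⟨k, m⟩ hαβ
    rw [sForm_congr (hΦae _) (hΦae _)]
    by_cases hjk : j = k
    · subst hjk
      rw [sForm_phiExt_self T φ hab]
      refine (hφ j).orthogonal _ _ fun him => hαβ ?_
      have him' : i = m := Fin.ext him
      rw [him']
    · exact sForm_phiExt_of_ne T φ hab hjk _ _
  -- The coefficients of the auxiliary projection as continuous functionals; by orthogonality of the
  -- `Φ α`, `s(πx, πy)` becomes `∑ n_α q_α(x) conj (q_α(y))`, the form of the abstract lemma.
  set q : A → Pair (box a b) →L[ℂ] ℂ := fun α =>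
    ((n α : ℂ)⁻¹) • (hS.toCLM (le_max_right C 0) hC (Φ α)).comp (WithLp.fstL 2 ℂ _ _) with hq
  have hq_apply : ∀ α v, q α v = sForm μ (box a b) v.fst (phiExt T φ α.1 α.2) / n α := by
    intro α v
    rw [div_eq_inv_mul, ← sForm_congr EventuallyEq.rfl (hΦae α)]
    rfl
  have hproj : ∀ v : Pair (box a b), auxProj T ε φ l v.fst =ᵐ[volume.restrict (box a b)]
      (∑ α, q α v • Φ α : L2 (box a b)) := by
    intro v
    refine (auxProj_ae_eq T φ hab l v.fst).trans (Eq.eventuallyEq ?_)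
    congr 2
    refine Finset.sum_congr rfl fun α _ => ?_
    rw [hself', hq_apply]
  obtain ⟨W, hW, hWc⟩ := exists_closed_submodule_H1P (isOpen_box a b).measurableSet
    (isBounded_box a b)
  have hmem : ∀ v, v ∈ W ↔ v ∈ H1P a b := fun v => by rw [← hW]; rfl
  have h0 := coeff_eq_zero_of_orthogonal (isHermForm_aForm hV hVmin.le ε)
    (lt_min (by positivity) hVmin : 0 < min (ε ^ 2 / 2) Vmin)
    (show 0 ≤ max (ε ^ 2 / 2) Vmax by positivity) (le_aForm_self hV hVmin.le ε)
    (aForm_self_le hV hVmin.le ε) W hWc hnpos q ((hmem e).2 he) (fun α ψ hψ hψeq => by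
      refine horth ψ (Submodule.subset_span ⟨α.1, α.2, α.2.2, (hmem ψ).1 hψ, fun v hv => ?_⟩)
        ((hmem ψ).1 hψ)
      obtain ⟨e1, e2⟩ := hS.orthogonal_expansion hself hne (fun β => q β ψ) (fun β => q β v)
      rw [sForm_congr (hproj ψ) (hproj v), sForm_congr (hΦae α).symm (hproj v), e1, e2]
      exact hψeq v ((hmem v).2 hv)) ⟨j, i, hi⟩
  rw [hq_apply] at h0
  rcases div_eq_zero_iff.1 h0 with h1 | h1
  · exact h1
  · exact absurd h1 (by exact_mod_cast (hnpos _).ne')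

lemma leastOmitted_le (j : Fin T.N) : leastOmitted T lam l ≤ lam j (l j) :=
  ciInf_le (Set.finite_range _).bddBelow j

/-- The mesh of a nonempty box has at least one element, so the infimum is an attained positive
eigenvalue and not the default value 0 of an empty infimum. -/
lemma leastOmitted_pos (hab : ∀ i, a i < b i) (hε : 0 < ε)
    (hVmin : 0 < Vmin) (hV : IsBddWeight V (box a b) Vmin Vmax)
    (hφ : ∀ j, IsEigensystem ε V (T.cell j) (lam j) (φ j)) : 0 < leastOmitted T lam l := by
  have := T.nonempty_fin hab
  obtain ⟨j, hj⟩ := exists_eq_ciInf_of_finite (f := fun j => lam j (l j))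
  rw [leastOmitted, ← hj]
  exact ((hφ j).pos hε hVmin (hV.mono_set (T.dom_subset hab j)) (l j)).2

/-- The spectral gap on the complement of the auxiliary space. -/
theorem leastOmitted_mul_sForm_le (hd : 1 ≤ d) (hab : ∀ i, a i < b i) (hε : 0 < ε)
    (hVmin : 0 < Vmin) (hV : IsBddWeight V (box a b) Vmin Vmax)
    (hφ : ∀ j, IsEigensystem ε V (T.cell j) (lam j) (φ j)) {e : Pair (box a b)}
    (he : e ∈ H1 (box a b))
    (horth : ∀ j, ∀ i < l j, sForm (T.weight ε) (box a b) e.fst (phiExt T φ j i) = 0) :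
    leastOmitted T lam l * (sForm (T.weight ε) (box a b) e.fst e.fst).re ≤
      (aForm ε V e e).re := by
  obtain ⟨C, hμ⟩ := T.isBddWeight hd ε
  have hc0 : 0 ≤ ε ^ 2 / (2 * 2 ^ d * T.size ^ 2) := by positivity
  set r : ∀ j, Pair (T.cell j).dom := fun j => restrictPair (T.dom_subset hab j) e with hr
  have hrfst : ∀ j, (r j).fst =ᵐ[volume.restrict (T.cell j).dom] e.fst := fun j =>
    restrictPair_fst _ _
  have hrsnd : ∀ j, (r j).snd =ᵐ[volume.restrict (T.cell j).dom] e.snd := fun j =>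
    restrictPair_snd _ _
  -- Both forms are sums over the elements, so the local gap estimates add up; each local eigenvalue
  -- is replaced by the smaller `Λ`.
  have hs : sForm (T.weight ε) (box a b) e.fst e.fst =
      ∑ j, sForm ((T.cell j).weight ε) (T.cell j).dom (r j).fst (r j).fst := by
    rw [sForm, T.setIntegral_eq_sum hab (hμ.integrable hc0 e.fst e.fst)]
    refine Finset.sum_congr rfl fun j _ => ?_
    refine integral_congr_ae ?_
    filter_upwards [hrfst j, ae_restrict_mem (T.cell j).isOpen_dom.measurableSet] with x hx hxd
    rw [hx, T.weight_eq ε hxd]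
  have ha : aForm ε V e e = ∑ j, aForm ε V (r j) (r j) := by
    have hint : IntegrableOn (fun x => ((ε ^ 2 / 2 : ℝ) : ℂ) * inner ℂ (e.snd x) (e.snd x) +
        (V x : ℂ) * e.fst x * conj (e.fst x)) (box a b) :=
      ((MeasureTheory.L2.integrable_inner e.snd e.snd).const_mul _).add
        (hV.integrable hVmin.le e.fst e.fst)
    rw [aForm, T.setIntegral_eq_sum hab hint]
    refine Finset.sum_congr rfl fun j _ => ?_
    refine integral_congr_ae ?_
    filter_upwards [hrfst j, hrsnd j] with x hx1 hx2
    rw [hx1, hx2]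
  rw [hs, ha, Complex.re_sum, Complex.re_sum, Finset.mul_sum]
  refine Finset.sum_le_sum fun j _ => ?_
  obtain ⟨B, -, hB⟩ := (T.cell j).exists_isBddWeight ε
  refine (mul_le_mul_of_nonneg_right (leastOmitted_le T j)
    ((hB.isHermForm le_rfl).nonneg (r j).fst)).trans ?_
  refine (hφ j).le_aForm hε hVmin (hV.mono_set (T.dom_subset hab j))
    (restrictPair_mem_H1 _ (isOpen_box a b).measurableSet he) fun i hi => ?_
  rw [sForm_congr (hrfst j) EventuallyEq.rfl, ← sForm_phiExt_right T φ hab]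
  exact horth j i hi

end Error

end CEM

/-! ### The error estimates -/

theorem theorem4p1 (d : ℕ) (hd : 1 ≤ d) :
    ∃ C : ℝ, 0 < C ∧
      ∀ (a b : Fin d → ℝ) (_hab : ∀ i, a i < b i) (T : CEM.CoarseMesh (CEM.box a b))
        (ε : ℝ) (_hε : 0 < ε)
        (V : CEM.E d → ℝ) (Vmin Vmax : ℝ) (_hVmin : 0 < Vmin)
        (_hVmeas : AEMeasurable V (volume.restrict (CEM.box a b)))
        (_hV : ∀ x ∈ CEM.box a b, Vmin ≤ V x ∧ V x ≤ Vmax)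
        (lam : Fin T.N → ℕ → ℝ) (φ : (j : Fin T.N) → ℕ → CEM.Pair (T.cell j).dom)
        (_hφ : ∀ j, CEM.IsEigensystem ε V (T.cell j) (lam j) (φ j))
        (l : Fin T.N → ℕ)
        (f : CEM.L2 (CEM.box a b)) (u uglo : CEM.Pair (CEM.box a b))
        (_hu : CEM.SolvesIn ε V (CEM.H1P a b) f u)
        (_huglo : CEM.SolvesIn ε V (CEM.Vglo T ε V φ l : Set (CEM.Pair (CEM.box a b))) f uglo),
        CEM.aNorm ε V (u - uglo) ≤
            CEM.sInvNorm (T.weight ε) (CEM.box a b) f / Real.sqrt (CEM.leastOmitted T lam l) ∧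
        CEM.sNorm (T.weight ε) (CEM.box a b) (u - uglo).fst ≤
            C / CEM.leastOmitted T lam l * CEM.sInvNorm (T.weight ε) (CEM.box a b) f ∧
        CEM.aNorm ε V (u - uglo) ≤
            C * T.size / (ε * Real.sqrt (CEM.leastOmitted T lam l)) * ‖f‖ ∧
        ‖(u - uglo).fst‖ ≤
            C * T.size ^ 2 / (CEM.leastOmitted T lam l * ε ^ 2) * ‖f‖ := by
  -- The reciprocal of the weight is at most `2 * 2 ^ d * H ^ 2 / ε ^ 2`. The `L²` estimate uses
  -- this factor exactly; the others need less.
  refine ⟨2 * 2 ^ d, by positivity, ?_⟩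
  intro a b hab T ε hε V Vmin Vmax hVmin hVmeas hVb lam φ hφ l f u uglo hu huglo
  have hV : CEM.IsBddWeight V (CEM.box a b) Vmin Vmax :=
    { aemeasurable := hVmeas
      lower := by
        filter_upwards [ae_restrict_mem (CEM.isOpen_box a b).measurableSet] with x hx
        exact (hVb x hx).1
      upper := by
        filter_upwards [ae_restrict_mem (CEM.isOpen_box a b).measurableSet] with x hx
        exact (hVb x hx).2 }
  obtain ⟨W, hW, -⟩ := CEM.exists_closed_submodule_H1P (CEM.isOpen_box a b).measurableSet
    (CEM.isBounded_box a b)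
  have hmem : ∀ v, v ∈ W ↔ v ∈ CEM.H1P a b := fun v => by rw [← hW]; rfl
  have hglo : CEM.Vglo T ε V φ l ≤ W := Submodule.span_le.2 fun ψ ⟨_, _, _, hψ⟩ =>
    (hmem ψ).2 hψ.1
  have hA := CEM.isHermForm_aForm hV hVmin.le ε
  have he : u - uglo ∈ CEM.H1P a b :=
    (hmem _).1 (W.sub_mem ((hmem u).2 hu.1) (hglo huglo.1))
  have horth : ∀ ψ ∈ CEM.Vglo T ε V φ l, CEM.aForm ε V (u - uglo) ψ = 0 := fun ψ hψ => by
    rw [hA.sub_left, hu.2 ψ ((hmem ψ).1 (hglo hψ)), huglo.2 ψ hψ, sub_self]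
  -- The part with `uglo` drops out by Galerkin orthogonality, since `uglo` itself lies in the
  -- multiscale space.
  have hgal : CEM.aForm ε V (u - uglo) (u - uglo) = CEM.l2Form f (u - uglo) := by
    rw [hA.sub_left, ← hA.conj_symm uglo, horth uglo huglo.1, map_zero, sub_zero, hu.2 _ he]
  obtain ⟨B, hμ⟩ := T.isBddWeight hd ε
  have hsize := T.size_pos hd hab
  set Λ := CEM.leastOmitted T lam l with hΛdef
  have hΛ : 0 < Λ := CEM.leastOmitted_pos T hab hε hVmin hV hφ
  set c := ε ^ 2 / (2 * 2 ^ d * T.size ^ 2) with hc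
  have hc0 : 0 < c := by positivity
  set e := u - uglo with hedef
  set X := CEM.aNorm ε V e with hX
  set Y := CEM.sNorm (T.weight ε) (CEM.box a b) e.fst with hY
  set N := CEM.sInvNorm (T.weight ε) (CEM.box a b) f with hN
  have hX0 : 0 ≤ X := Real.sqrt_nonneg _
  have hY0 : 0 ≤ Y := Real.sqrt_nonneg _
  have hN0 : 0 ≤ N := Real.sqrt_nonneg _
  have hXsq : X ^ 2 = (CEM.aForm ε V e e).re := Real.sq_sqrt (hA.nonneg e)
  have hYsq : Y ^ 2 = (CEM.sForm (T.weight ε) (CEM.box a b) e.fst e.fst).re :=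
    Real.sq_sqrt ((hμ.isHermForm hc0.le).nonneg e.fst)
  have hgap : Λ * Y ^ 2 ≤ X ^ 2 := by
    rw [hXsq, hYsq]
    exact CEM.leastOmitted_mul_sForm_le T hd hab hε hVmin hV hφ he.1 fun j i hi =>
      CEM.sForm_phiExt_eq_zero_of_orthogonal T hd hab hε hVmin hV hφ he
        (fun ψ hψ _ => horth ψ hψ) j hi
  have hdual : X ^ 2 ≤ N * Y := by
    rw [hXsq, hgal]
    exact ((Complex.abs_re_le_norm _).trans (hμ.norm_l2Form_le hc0 f e)).trans' (le_abs_self _)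
  set s := Real.sqrt Λ with hs
  have hs0 : 0 < s := Real.sqrt_pos.2 hΛ
  have hsΛ : s ^ 2 = Λ := Real.sq_sqrt hΛ.le
  have hYX : s * Y ≤ X :=
    le_of_sq_le_sq (by rw [mul_pow, hsΛ]; exact hgap) hX0
  -- From `X ^ 2 ≤ N * Y` and `s * Y ≤ X` by cancelling one factor `X`; hence the separate case `X =
  -- 0`.
  have hXN : s * X ≤ N := by
    rcases hX0.eq_or_lt with h | h
    · rw [← h, mul_zero]; exact hN0
    · refine le_of_mul_le_mul_right ?_ h
      calc s * X * X = s * X ^ 2 := by ring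
        _ ≤ s * (N * Y) := by gcongr
        _ = N * (s * Y) := by ring
        _ ≤ N * X := by gcongr
  have hYN : Λ * Y ≤ N := by
    rw [← hsΛ]
    calc s ^ 2 * Y = s * (s * Y) := by ring
      _ ≤ s * X := by gcongr
      _ ≤ N := hXN
  set k := Real.sqrt c⁻¹ with hk
  have hksq : k ^ 2 = 2 * 2 ^ d * T.size ^ 2 / ε ^ 2 := by
    rw [hk, Real.sq_sqrt (by positivity), hc, inv_div]
  have hk0 : 0 ≤ k := Real.sqrt_nonneg _
  have hone : (1 : ℝ) ≤ 2 * 2 ^ d := by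
    have : (1 : ℝ) ≤ 2 ^ d := one_le_pow₀ (by norm_num)
    linarith
  -- Here `k` is `√(2 * 2 ^ d) * H / ε`, and the square root is dropped because `2 * 2 ^ d ≥ 1`.
  have hk_le : k ≤ 2 * 2 ^ d * T.size / ε := by
    refine le_of_sq_le_sq ?_ (by positivity)
    rw [hksq, div_pow, mul_pow]
    gcongr
    nlinarith
  have hNf : N ≤ k * ‖f‖ := hμ.sInvNorm_le hc0 f
  have heY : ‖e.fst‖ ≤ k * Y := by
    refine le_of_sq_le_sq ?_ (by positivity)
    rw [mul_pow, hk, Real.sq_sqrt (by positivity), hYsq, ← div_eq_inv_mul, le_div_iff₀' hc0]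
    exact hμ.le_sForm_self hc0.le e.fst
  refine ⟨?_, ?_, ?_, ?_⟩
  · rw [le_div_iff₀ hs0, mul_comm]
    exact hXN
  · calc Y ≤ N / Λ := by rw [le_div_iff₀ hΛ, mul_comm]; exact hYN
      _ = 1 / Λ * N := by ring
      _ ≤ 2 * 2 ^ d / Λ * N := by gcongr
  · calc X ≤ N / s := by rw [le_div_iff₀ hs0, mul_comm]; exact hXN
      _ ≤ 2 * 2 ^ d * T.size / ε * ‖f‖ / s := by
          gcongr
          exact hNf.trans (by gcongr)
      _ = _ := by field_simp
  -- The factor `k` enters twice, from `‖e‖ ≤ k ‖e‖_s` and from `‖f‖_{s⁻¹} ≤ k ‖f‖`; this produces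
  -- the second order in `H`.
  · calc ‖e.fst‖ ≤ k * Y := heY
      _ ≤ k * (N / Λ) := by
          gcongr
          rw [le_div_iff₀ hΛ, mul_comm]
          exact hYN
      _ ≤ k * (k * ‖f‖ / Λ) := by gcongr
      _ = k ^ 2 * ‖f‖ / Λ := by ring
      _ = _ := by rw [hksq]; field_simp
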